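/- Let $b\ge 1$ be an integer. Let $\Gamma_0[b]\subset \mathrm{PSL}_2(\mathbb Z)$ be Hecke's congruence subgroup (classes of matrices that are upper triangular modulo $b$), acting by homographies on the upper half-plane $\mathbb H^2=\{z\in\mathbb C:\operatorname{Im} z>0\}$ with its hyperbolic metric of curvature $-1$, and let $\mathcal H_\infty=\{z:\operatorname{Im} z\ge 1\}$, whose image in $\Gamma_0[b]\backslash\mathbb H^2$ is a Margulis neighbourhood of a cusp. A common perpendicular from this cusp neighbourhood to itself is a $\Gamma_0[b]$-orbit $\alpha$ of (oriented) shortest arcs $\tilde\alpha$ from $\mathcal H_\infty$ to $\gamma\mathcal H_\infty$, where $\gamma\in\Gamma_0[b]$ satisfies $d(\mathcal H_\infty,\gamma\mathcal H_\infty)>0$. Its length $\lambda(\alpha)$ is the length of $\tilde\alpha$. Its multiplicity $\operatorname{mult}(\alpha)$ is the number of pairs of $\Gamma_0[b]$-translates of $\mathcal H_\infty$ such that $\tilde\alpha$ is the shortest arc from the first to the second, divided by the order of the pointwise stabilizer of $\tilde\alpha$ in $\Gamma_0[b]$. For $\ell>0$ let $\omega(\ell)=\sum_{\lambda(\alpha)=\ell}\operatorname{mult}(\alpha)$,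 let $F_N$ be the set of lengths of common perpendiculars lying in $[0,2\ln N]$, and for $\psi:\mathbb N\to[0,+\infty[$ let $$\mathcal R_N^{b,\psi}=\sum_{x,y\in F_N,\ x\neq y}\omega(x)\,\omega(y)\,\Delta_{\psi(N)(y-x)},$$ where $\Delta_z$ is the unit Dirac mass at $z$. For integers $a,b,k\ge 1$, with $(p,b)$ denoting the gcd and $p$ ranging over primes, let $$c_{a,b,k}=\frac1b\prod_{p:\,(p,b)\mid k+a}\Big(1-\frac{(p,b)}{p^2}\Big)\prod_{p:\,(p,b)\mid a}\Big(1-(p,b)\frac{\kappa_{a,b,k}(p)\,\kappa'_k(p)}{p^2}\Big),$$ where $\kappa_{a,b,k}(p)=\big(1-\frac{(p,b)}{p^2}\big)^{-1}$ if $(p,b)\mid a+k$ and $1$ otherwise, and $\kappa'_k(p)=1-\frac1p$ if $p\mid k$ and $1$ otherwise. Corollary 6.2. For every $b\ge1$, as $N\to+\infty$, the following hold, where weak-star convergence means convergence of integrals of continuous functions with compact support. (1) (No scaling, $\psi\equiv1$.) The measures $\mathcal R_N^{b,1}$, renormalized to be probability measures (which is possible for all $N$ large enough), weak-star converge to the measure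 on $\mathbb R$ with density $s\mapsto\frac12e^{-|s|}$ with respect to the Lebesgue measure. (2) (Linear scaling, $\psi(N)=N$.) The measures $\frac1{N^3}\mathcal R_N^{b,\mathrm{id}}$ weak-star converge to the measure on $\mathbb R$ with density $$s\mapsto\frac{8}{s^4}\sum_{1\le k\le |s|/2,\ b\mid k}c_{b,b,k}\,k^3$$ (equal to $0$ for $|s|<2$) with respect to the Lebesgue measure. -/

import Mathlib

open MeasureTheory Filter Topology
open scoped ENNReal Pointwise MatrixGroups UpperHalfPlane

noncomputable section

namespace PairCorr

/-! ### Weak-star convergence and pair correlation measures -/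

/-- Weak-star convergence of locally finite measures on the real line, tested against continuous
functions with compact support. The local finiteness of the limit and, eventually, of the measures
of the sequence is part of the definition, so that all the integrals are genuine. -/
def WeakStarTendsto (μ : ℕ → Measure ℝ) (ν : Measure ℝ) : Prop :=
  (∀ᶠ N in atTop, IsLocallyFiniteMeasure (μ N)) ∧ IsLocallyFiniteMeasure ν ∧
    ∀ f : ℝ → ℂ, Continuous f → HasCompactSupport f →
      Tendsto (fun N => ∫ s, f s ∂(μ N)) atTop (𝓝 (∫ s, f s ∂ν))

/-- The pair correlation measure, at time `N` with scaling `ψ N`, of a family `F` of sets of real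
numbers with multiplicity function `ω`: the sum over the pairs `(x, y)` of distinct elements
of `F N` of the Dirac masses at `ψ N * (y - x)`, with weights `ω x * ω y`. -/
def pairCorrelationMeasure (F : ℕ → Set ℝ) (ω : ℝ → ℝ≥0∞) (ψ : ℕ → ℝ) (N : ℕ) : Measure ℝ :=
  Measure.sum fun p : {p : ℝ × ℝ // p.1 ∈ F N ∧ p.2 ∈ F N ∧ p.1 ≠ p.2} =>
    (ω p.1.1 * ω p.1.2) • Measure.dirac (ψ N * (p.1.2 - p.1.1))

/-! ### Common perpendiculars

`X` is a uniquely geodesic metric space on which a group `Γ` acts by isometries. An oriented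
geodesic arc is represented by the pair of its origin and its terminal point, which determine it;
its length is the distance between them. -/

section Perp

variable {X : Type*} [MetricSpace X]

/-- The geodesic arc with the given pair of endpoints is a shortest arc from `A` to `B`. -/
def IsShortestArc (A B : Set X) (p : X × X) : Prop :=
  p.1 ∈ A ∧ p.2 ∈ B ∧ ∀ x ∈ A, ∀ y ∈ B, dist p.1 p.2 ≤ dist x y

/-- The trace of the geodesic arc from `p.1` to `p.2`. -/
def arcTrace (p : X × X) : Set X :=
  {z | dist p.1 z + dist z p.2 = dist p.1 p.2}

variable (Γ : Type*) [Group Γ] [MulAction Γ X]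

/-- The pairs `(γ₋ Dm, γ₊ Dp)` of translates of `Dm` and of `Dp` between which the given arc is a
shortest arc. Translates of a set correspond to cosets of its stabilizer. -/
def translatePairs (Dm Dp : Set X) (p : X × X) : Set (Set X × Set X) :=
  {C | C.1 ∈ MulAction.orbit Γ Dm ∧ C.2 ∈ MulAction.orbit Γ Dp ∧ IsShortestArc C.1 C.2 p}

/-- The elements of `Γ` fixing the given arc pointwise. -/
def arcFixator (p : X × X) : Set Γ :=
  {g | ∀ z ∈ arcTrace p, g • z = z}

/-- The multiplicity of an arc: the number of pairs of translates between which it is a shortest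
arc, divided by the order of its pointwise stabilizer. -/
def arcMult (Dm Dp : Set X) (p : X × X) : ℝ≥0∞ :=
  ((translatePairs Γ Dm Dp p).encard : ℝ≥0∞) / ((arcFixator Γ p).encard : ℝ≥0∞)

variable [IsIsometricSMul Γ X]

theorem isShortestArc_smul {A B : Set X} {p : X × X} (g : Γ) (h : IsShortestArc A B p) :
    IsShortestArc (g • A) (g • B) (g • p) := by
  obtain ⟨h1, h2, h3⟩ := h
  refine ⟨Set.smul_mem_smul_set h1, Set.smul_mem_smul_set h2, ?_⟩
  rintro _ ⟨x, hx, rfl⟩ _ ⟨y, hy, rfl⟩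
  simpa only [Prod.smul_fst, Prod.smul_snd, dist_smul] using h3 x hx y hy

theorem translatePairs_encard_le (Dm Dp : Set X) (g : Γ) (p : X × X) :
    (translatePairs Γ Dm Dp p).encard ≤ (translatePairs Γ Dm Dp (g • p)).encard := by
  refine Set.encard_le_encard_of_injOn (f := fun C => g • C) ?_
    (MulAction.injective g).injOn
  rintro C ⟨h1, h2, h3⟩
  exact ⟨MulAction.mem_orbit_of_mem_orbit g h1, MulAction.mem_orbit_of_mem_orbit g h2,
    isShortestArc_smul Γ g h3⟩

theorem arcFixator_encard_le (g : Γ) (p : X × X) :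
    (arcFixator Γ p).encard ≤ (arcFixator Γ (g • p)).encard := by
  refine Set.encard_le_encard_of_injOn (f := fun h => g * h * g⁻¹) ?_ ?_
  · intro h hh z hz
    have hz' : g⁻¹ • z ∈ arcTrace p := by
      have e1 : dist (g • p.1) z = dist p.1 (g⁻¹ • z) := by
        rw [← dist_smul g⁻¹, inv_smul_smul]
      have e2 : dist z (g • p.2) = dist (g⁻¹ • z) p.2 := by
        rw [← dist_smul g⁻¹, inv_smul_smul]
      simpa only [arcTrace, Set.mem_ofPred_eq, Prod.smul_fst, Prod.smul_snd, e1, e2,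
        dist_smul] using hz
    rw [mul_smul, mul_smul, hh _ hz', smul_inv_smul]
  · intro h _ h' _ e
    simpa using e

theorem arcMult_smul (Dm Dp : Set X) (g : Γ) (p : X × X) :
    arcMult Γ Dm Dp (g • p) = arcMult Γ Dm Dp p := by
  have e1 : (translatePairs Γ Dm Dp (g • p)).encard = (translatePairs Γ Dm Dp p).encard :=
    le_antisymm (by simpa using translatePairs_encard_le Γ Dm Dp g⁻¹ (g • p))
      (translatePairs_encard_le Γ Dm Dp g p)
  have e2 : (arcFixator Γ (g • p)).encard = (arcFixator Γ p).encard :=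
    le_antisymm (by simpa using arcFixator_encard_le Γ g⁻¹ (g • p))
      (arcFixator_encard_le Γ g p)
  rw [arcMult, arcMult, e1, e2]

/-- The set of common perpendiculars from `Γ \ Γ Dm` to `Γ \ Γ Dp`: the `Γ`-orbits of the shortest
arcs from `Dm` to `γ Dp`, where `γ` is an element of `Γ` such that the distance from `Dm`
to `γ Dp` is positive. -/
def commonPerp (Dm Dp : Set X) : Set (MulAction.orbitRel.Quotient Γ (X × X)) :=
  {α | ∃ (γ : Γ) (p : X × X), IsShortestArc Dm (γ • Dp) p ∧ 0 < dist p.1 p.2 ∧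
    (Quotient.mk _ p : MulAction.orbitRel.Quotient Γ (X × X)) = α}

/-- The length of an orbit of arcs. -/
def orbitLength : MulAction.orbitRel.Quotient Γ (X × X) → ℝ :=
  Quotient.lift (fun p : X × X => dist p.1 p.2) <| by
    rintro _ q ⟨g, rfl⟩
    exact dist_smul g q.1 q.2

/-- The multiplicity of an orbit of arcs. -/
def orbitMult (Dm Dp : Set X) : MulAction.orbitRel.Quotient Γ (X × X) → ℝ≥0∞ :=
  Quotient.lift (arcMult Γ Dm Dp) <| by
    rintro _ q ⟨g, rfl⟩
    exact arcMult_smul Γ Dm Dp g q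

/-- The set of lengths of the common perpendiculars. -/
def orthoLengths (Dm Dp : Set X) : Set ℝ :=
  orbitLength Γ '' commonPerp Γ Dm Dp

/-- The length multiplicity: the sum of the multiplicities of the common perpendiculars of
length `ℓ`. -/
def lengthMult (Dm Dp : Set X) (ℓ : ℝ) : ℝ≥0∞ :=
  ∑' α : {α : MulAction.orbitRel.Quotient Γ (X × X) //
    α ∈ commonPerp Γ Dm Dp ∧ orbitLength Γ α = ℓ}, orbitMult Γ Dm Dp α.1

/-- The pair correlation measure of the lengths of the common perpendiculars, that is of the family
of the sets of lengths at most `2 log N`, with their length multiplicities. -/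
def perpPairCorrelation (Dm Dp : Set X) (ψ : ℕ → ℝ) (N : ℕ) : Measure ℝ :=
  pairCorrelationMeasure
    (fun M => orthoLengths Γ Dm Dp ∩ Set.Icc 0 (2 * Real.log M)) (lengthMult Γ Dm Dp) ψ N

end Perp

/-! ### The modular group and Hecke's congruence subgroups -/

/-- The modular group `PSL₂(ℤ)`. -/
abbrev ModularGroup : Type := Matrix.ProjectiveSpecialLinearGroup (Fin 2) ℤ

theorem center_smul (g : SL(2, ℤ)) (hg : g ∈ Subgroup.center SL(2, ℤ)) (z : ℍ) : g • z = z := by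
  obtain ⟨r, hr, h⟩ := Matrix.SpecialLinearGroup.mem_center_iff.mp hg
  have hr' : r = 1 ∨ r = -1 := by
    have : r ^ 2 = 1 := by simpa using hr
    exact Int.isUnit_iff.mp (IsUnit.of_mul_eq_one r (by rw [← sq, this]))
  rcases hr' with rfl | rfl
  · have : g = 1 := by
      ext i j
      simp [← h]
    simp [this]
  · have : g = -1 := by
      ext i j
      simp [← h]
    simp [this]

/-- The action of the modular group on the upper half-plane by homographies. -/
def modularToPerm : ModularGroup →* Equiv.Perm ℍ :=
  QuotientGroup.lift (Subgroup.center SL(2, ℤ)) (MulAction.toPermHom SL(2, ℤ) ℍ) fun g hg =>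
    Equiv.ext (center_smul g hg)

instance instMulActionModularGroup : MulAction ModularGroup ℍ :=
  MulAction.compHom ℍ modularToPerm

theorem mk_smul (g : SL(2, ℤ)) (z : ℍ) :
    (QuotientGroup.mk' (Subgroup.center SL(2, ℤ)) g : ModularGroup) • z = g • z := rfl

instance instIsIsometricSMulModularGroup : IsIsometricSMul ModularGroup ℍ := by
  refine ⟨fun g => ?_⟩
  obtain ⟨g, rfl⟩ := QuotientGroup.mk'_surjective (Subgroup.center SL(2, ℤ)) g
  exact isometry_smul ℍ (g : SL(2, ℝ))

instance instIsIsometricSMulSubgroup (H : Subgroup ModularGroup) : IsIsometricSMul H ℍ :=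
  ⟨fun g => isometry_smul ℍ (g : ModularGroup)⟩

/-- Hecke's congruence subgroup `Γ₀[b]` of the modular group: the classes of the matrices that are
upper triangular modulo `b`. -/
def heckeGroup (b : ℕ) : Subgroup ModularGroup :=
  (CongruenceSubgroup.Gamma0 b).map (QuotientGroup.mk' (Subgroup.center SL(2, ℤ)))

/-- The horoball centred at infinity of the points with imaginary part at least `1`. -/
def horoball : Set ℍ := {z | 1 ≤ z.im}

/-- The pair correlation measure at time `N`, with scaling `ψ`, of the lengths of the common
perpendiculars from the Margulis cusp neighbourhood (the image of the horoball) to itself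
in `Γ₀[b] \ ℍ`. -/
def cuspPairCorrelation (b : ℕ) (ψ : ℕ → ℝ) (N : ℕ) : Measure ℝ :=
  perpPairCorrelation (heckeGroup b) horoball horoball ψ N

/-! ### The arithmetic constants -/

/-- The factor `κ_{a,b,k}(p)` in the Euler product below. -/
def kappa (a b k p : ℕ) : ℝ :=
  if Nat.gcd p b ∣ a + k then (1 - (Nat.gcd p b : ℝ) / (p : ℝ) ^ 2)⁻¹ else 1

/-- The factor `κ'_k(p)` in the Euler product below. -/
def kappa' (k p : ℕ) : ℝ :=
  if p ∣ k then 1 - 1 / (p : ℝ) else 1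

/-- The constant `c_{a,b,k}`, a product of two Euler products. -/
def mirskyConst (a b k : ℕ) : ℝ :=
  1 / (b : ℝ) *
    (∏' p : Nat.Primes,
      if Nat.gcd p b ∣ k + a then 1 - (Nat.gcd p b : ℝ) / (p : ℝ) ^ 2 else 1) *
    ∏' p : Nat.Primes,
      if Nat.gcd p b ∣ a then
        1 - (Nat.gcd p b : ℝ) * (kappa a b k p * kappa' k p / (p : ℝ) ^ 2) else 1

/-- The pair correlation function of the lengths of common perpendiculars for the linear scaling,
`8 s⁻⁴ ∑ c_{b,b,k} k³` over the multiples `k` of `b` with `1 ≤ k ≤ |s| / 2`. -/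
def linearDensity (b : ℕ) (s : ℝ) : ℝ :=
  8 / s ^ 4 * ∑ k ∈ (Finset.Icc 1 ⌊|s| / 2⌋₊).filter (b ∣ ·), mirskyConst b b k * (k : ℝ) ^ 3

end PairCorr

end

/-!
# Pair correlations of the lengths of common perpendiculars of a cusp neighbourhood

**Reduction to Euler's function.** The translates of the horoball `{im ≥ 1}` by `Γ₀[b]` are itself
and the horoballs tangent to the real line at the fractions `a / c` in lowest terms with `b ∣ c`,
of Euclidean diameter `1 / c²`. The only shortest arc from the horoball at infinity to the one
at `a / c` is the vertical segment above `a / c` (`eq_footArc_of_isShortestArc`), of length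
`2 log c`. Two such segments are in the same orbit if and only if they differ by an integral
translation (`footOrbit_eq_iff`), and each has multiplicity one (`arcMult_footArc`). Hence the
lengths are the numbers `2 log c` with `c ≥ 2` and `b ∣ c`, the length multiplicity of `2 log c`
is `φ(c)` (`lengthMult_two_log`), and the pair correlation measure is
`∑ φ(c) φ(c') δ_{2 ψ(N) (log c' - log c)}` over the pairs of distinct such integers at most `N`
(`cuspPairCorrelation_eq_sum`).

**Mean values.** The ratio `φ(n) / n = ∏_{p ∣ n} (1 - 1 / p)` is approximated by the product over
the primes `p < P`, with an error of at most `∑_{p ∣ n, p ≥ P} 1 / p`, whose mean over `n` is at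
most `∑_{m ≥ P} 1 / m²`. The truncated products are periodic, and their means are computed prime
by prime with the Chinese remainder theorem (`periodicMean_prod`). So the ratio has a positive
mean over the multiples of `b`, and `φ(n) φ(n + k) / (n (n + k))` has the mean `c_{b,b,k}` over the
multiples of `b` when `b ∣ k` (`hasMean_totientRatio_mul`). An arithmetic function with mean `m` may
then be used as a weight in Riemann sums (`tendsto_weighted_riemann_sum`): the sums converge to `m`
times the integral.

**No scaling.** If `c ≤ N` is chosen with probability proportional to `φ(c)`, then `c / N`
converges in law to the density `2 t` on `[0, 1]`, so `2 log (c / N)` converges in law to the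
opposite of a standard exponential variable. The difference of two independent copies has the
density `exp (-|s|) / 2` (`map_sub_negExpMeasure`), and the diagonal is negligible.

**Linear scaling.** For a test function supported in `[-2 K, 2 K]`, only the pairs `(c, c ± k)` with
`k ≤ K` and `b ∣ k` contribute, and `2 N log (1 + k / c)` is close to `2 k / t` with `t = c / N`.
The pairs with difference `k` contribute `c_{b,b,k} ∫₀¹ t² f(2 k / t) dt` in the limit
(`tendsto_shift_sum`), and the change of variable `s = 2 k / t` yields the density
`8 c_{b,b,k} k³ / s⁴` on `s ≥ 2 k`.
-/

noncomputable section

namespace PairCorr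

/-! ### Mean values of arithmetic functions -/

/-- The function `h` has mean value `m` along the positive integers. -/
def HasMean (h : ℕ → ℝ) (m : ℝ) : Prop :=
  Tendsto (fun N : ℕ => (∑ n ∈ Finset.Ioc 0 N, h n) / N) atTop (𝓝 m)

/-- The function `h` is periodic of period `Q > 0`, and its mean over a period is `m`. -/
structure PeriodicMean (h : ℕ → ℝ) (Q : ℕ) (m : ℝ) : Prop where
  pos : 0 < Q
  periodic : Function.Periodic h Q
  sum_eq : ∑ n ∈ Finset.range Q, h n = Q * m

theorem sum_range_add_periodic {h : ℕ → ℝ} {Q : ℕ} (hp : Function.Periodic h Q) (k : ℕ) :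
    ∑ n ∈ Finset.range Q, h (n + k) = ∑ n ∈ Finset.range Q, h n := by
  induction k with
  | zero => rfl
  | succ k ih =>
    have h1 := Finset.sum_range_succ (fun n => h (n + k)) Q
    have h2 := Finset.sum_range_succ' (fun n => h (n + k)) Q
    have h3 : h (Q + k) = h (0 + k) := by rw [add_comm Q, zero_add]; exact hp k
    have h4 : ∀ n, h (n + 1 + k) = h (n + (k + 1)) := fun n => by rw [add_assoc, add_comm 1]
    simp only [h4] at h2
    linarith

theorem sum_Ioc_periodic {h : ℕ → ℝ} {Q : ℕ} (hp : Function.Periodic h Q) (N : ℕ) :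
    ∑ n ∈ Finset.Ioc N (N + Q), h n = ∑ n ∈ Finset.range Q, h n := by
  rw [← sum_range_add_periodic hp (N + 1), Finset.range_eq_Ico, Finset.sum_Ico_add']
  refine Finset.sum_congr ?_ fun _ _ => rfl
  ext n
  simp only [Finset.mem_Ioc, Finset.mem_Ico]
  omega

theorem PeriodicMean.add {f g : ℕ → ℝ} {Q : ℕ} {m m' : ℝ} (hf : PeriodicMean f Q m)
    (hg : PeriodicMean g Q m') : PeriodicMean (fun n => f n + g n) Q (m + m') :=
  ⟨hf.pos, hf.periodic.add hg.periodic, by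
    rw [Finset.sum_add_distrib, hf.sum_eq, hg.sum_eq, mul_add]⟩

theorem PeriodicMean.const_mul {f : ℕ → ℝ} {Q : ℕ} {m : ℝ} (hf : PeriodicMean f Q m) (c : ℝ) :
    PeriodicMean (fun n => c * f n) Q (c * m) :=
  ⟨hf.pos, fun n => congrArg (c * ·) (hf.periodic n), by
    rw [← Finset.mul_sum, hf.sum_eq]; ring⟩

theorem PeriodicMean.shift {f : ℕ → ℝ} {Q : ℕ} {m : ℝ} (hf : PeriodicMean f Q m) (k : ℕ) :
    PeriodicMean (fun n => f (n + k)) Q m :=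
  ⟨hf.pos, fun n => by rw [show n + Q + k = n + k + Q by ring]; exact hf.periodic _, by
    rw [sum_range_add_periodic hf.periodic, hf.sum_eq]⟩

theorem periodicMean_const {Q : ℕ} (hQ : 0 < Q) (c : ℝ) : PeriodicMean (fun _ => c) Q c :=
  ⟨hQ, fun _ => rfl, by simp⟩

theorem PeriodicMean.hasMean {h : ℕ → ℝ} {Q : ℕ} {m : ℝ} (H : PeriodicMean h Q m) :
    HasMean h m := by
  -- The discrepancy of the partial sums is itself periodic, hence bounded.
  set D : ℕ → ℝ := fun N => (∑ n ∈ Finset.Ioc 0 N, h n) - N * m with hD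
  have hper : Function.Periodic D Q := by
    intro N
    have h1 := Finset.sum_Ioc_consecutive h (Nat.zero_le N) (show N ≤ N + Q by omega)
    rw [sum_Ioc_periodic H.periodic N, H.sum_eq] at h1
    simp only [hD]
    push_cast
    linarith
  obtain ⟨C, hC⟩ : ∃ C, ∀ N, |D N| ≤ C := by
    refine ⟨∑ i ∈ Finset.range Q, |D i|, fun N => ?_⟩
    rw [← hper.map_mod_nat N]
    exact Finset.single_le_sum (f := fun i => |D i|) (fun i _ => abs_nonneg _)
      (Finset.mem_range.mpr (Nat.mod_lt _ H.pos))
  have h0 : Tendsto (fun N : ℕ => D N / N) atTop (𝓝 0) := by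
    refine squeeze_zero_norm (a := fun N : ℕ => C / N) (fun N => ?_)
      (tendsto_const_div_atTop_nhds_zero_nat C)
    rw [norm_div, Real.norm_eq_abs, Real.norm_natCast]
    gcongr
    exact hC N
  have h1 := h0.add_const m
  rw [zero_add] at h1
  refine h1.congr' ?_
  filter_upwards [eventually_gt_atTop 0] with N hN
  have : (N : ℝ) ≠ 0 := by positivity
  simp only [hD]
  field_simp
  ring

/-- The Chinese remainder theorem: functions with coprime periods are uncorrelated. -/
theorem PeriodicMean.mul {f g : ℕ → ℝ} {Q R : ℕ} {m m' : ℝ} (hf : PeriodicMean f Q m)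
    (hg : PeriodicMean g R m') (hQR : Q.Coprime R) :
    PeriodicMean (fun n => f n * g n) (Q * R) (m * m') := by
  refine ⟨Nat.mul_pos hf.pos hg.pos, fun n => ?_, ?_⟩
  · have h1 : f (n + Q * R) = f n := by
      have := hf.periodic.nat_mul R n
      rwa [Nat.cast_id, mul_comm] at this
    have h2 : g (n + Q * R) = g n := by
      have := hg.periodic.nat_mul Q n
      rwa [Nat.cast_id] at this
    simp only [h1, h2]
  · have key : ∑ n ∈ Finset.range (Q * R), f n * g n =
        ∑ x ∈ Finset.range Q ×ˢ Finset.range R, f x.1 * g x.2 := by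
      refine Finset.sum_bij (fun n _ => (n % Q, n % R)) ?_ ?_ ?_ ?_
      · intro n _
        simp [Nat.mod_lt _ hf.pos, Nat.mod_lt _ hg.pos]
      · intro x hx y hy hxy
        simp only [Finset.mem_range] at hx hy
        simp only [Prod.mk.injEq] at hxy
        have : x ≡ y [MOD Q * R] :=
          (Nat.modEq_and_modEq_iff_modEq_mul hQR).mp ⟨hxy.1, hxy.2⟩
        exact Nat.ModEq.eq_of_lt_of_lt this hx hy
      · rintro ⟨x, y⟩ hxy
        simp only [Finset.mem_product, Finset.mem_range] at hxy
        refine ⟨Nat.chineseRemainder hQR x y, ?_, ?_⟩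
        · exact Finset.mem_range.mpr (Nat.chineseRemainder_lt_mul hQR x y hf.pos.ne' hg.pos.ne')
        · have h1 := (Nat.chineseRemainder hQR x y).2.1
          have h2 := (Nat.chineseRemainder hQR x y).2.2
          rw [Nat.ModEq, Nat.mod_eq_of_lt hxy.1] at h1
          rw [Nat.ModEq, Nat.mod_eq_of_lt hxy.2] at h2
          exact Prod.ext h1 h2
      · intro n _
        rw [hf.periodic.map_mod_nat, hg.periodic.map_mod_nat]
    rw [key, Finset.sum_product, ← Finset.sum_mul_sum, hf.sum_eq, hg.sum_eq]
    push_cast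
    ring

theorem periodicMean_dvd {b : ℕ} (hb : 0 < b) :
    PeriodicMean (fun n => if b ∣ n then 1 else 0) b (1 / b) := by
  refine ⟨hb, fun n => by simp, ?_⟩
  have hb' : (b : ℝ) ≠ 0 := by positivity
  rw [mul_one_div_cancel hb', Finset.sum_eq_single_of_mem 0 (Finset.mem_range.mpr hb)]
  · simp
  · intro n hn h0
    rw [if_neg]
    intro h
    exact absurd (Nat.le_of_dvd (Nat.pos_of_ne_zero h0) h) (not_le.mpr (Finset.mem_range.mp hn))

/-- The mean over the multiples of `b` of a finite product of functions indexed by primes: the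
factor at `p` is `p`-periodic when `p ∤ b`, and constant on the multiples of `b` when `p ∣ b`. -/
theorem periodicMean_prod {b : ℕ} (hb : 0 < b) {f : ℕ → ℕ → ℝ} {a : ℕ → ℝ} (s : Finset ℕ)
    (hs : ∀ p ∈ s, p.Prime) (h1 : ∀ p ∈ s, ¬ p ∣ b → PeriodicMean (f p) p (a p))
    (h2 : ∀ p ∈ s, p ∣ b → ∀ n, b ∣ n → f p n = a p) :
    PeriodicMean (fun n => if b ∣ n then ∏ p ∈ s, f p n else 0)
      (b * ∏ p ∈ s.filter (fun p => ¬ p ∣ b), p) (1 / b * ∏ p ∈ s, a p) := by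
  induction s using Finset.induction_on with
  | empty => simpa using periodicMean_dvd hb
  | insert q s hq ih =>
    have ih := ih (fun p hp => hs p (Finset.mem_insert_of_mem hp))
      (fun p hp => h1 p (Finset.mem_insert_of_mem hp))
      (fun p hp => h2 p (Finset.mem_insert_of_mem hp))
    have hqs := Finset.mem_insert_self q s
    rw [Finset.prod_insert hq, Finset.filter_insert]
    by_cases hqb : q ∣ b
    · rw [if_neg (not_not.mpr hqb)]
      have he : (fun n => if b ∣ n then ∏ p ∈ insert q s, f p n else 0) =
          fun n => a q * if b ∣ n then ∏ p ∈ s, f p n else 0 := by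
        funext n
        split_ifs with hn
        · rw [Finset.prod_insert hq, h2 q hqs hqb n hn]
        · simp
      rw [he]
      convert ih.const_mul (a q) using 1
      ring
    · rw [if_pos hqb, Finset.prod_insert (by simp [hq])]
      have hco : (b * ∏ p ∈ s.filter (fun p => ¬ p ∣ b), p).Coprime q := by
        refine Nat.Coprime.mul_left ?_ (Nat.Coprime.prod_left fun p hp => ?_)
        · exact ((hs q hqs).coprime_iff_not_dvd.mpr hqb).symm
        · have hps := (Finset.mem_filter.mp hp).1
          exact (Nat.coprime_primes (hs p (Finset.mem_insert_of_mem hps)) (hs q hqs)).mpr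
            fun h => hq (h ▸ hps)
      convert ih.mul (h1 q hqs hqb) hco using 1
      · funext n
        split_ifs with hn
        · rw [Finset.prod_insert hq, mul_comm]
        · simp
      · ring
      · ring

/-- A function that is approximated in mean by functions having a mean has a mean. -/
theorem HasMean.of_approx {h : ℕ → ℝ} {m : ℝ} {g : ℕ → ℕ → ℝ} {μ ε : ℕ → ℝ} (k : ℕ)
    (hg : ∀ P, HasMean (g P) (μ P)) (hμ : Tendsto μ atTop (𝓝 m)) (hε : Tendsto ε atTop (𝓝 0))
    (happ : ∀ P N, |∑ n ∈ Finset.Ioc 0 N, (h n - g P n)| ≤ (N + k) * ε P) : HasMean h m := by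
  rw [HasMean, Metric.tendsto_atTop]
  intro δ hδ
  have hδ4 : 0 < δ / 4 := by positivity
  obtain ⟨P, hP1, hP2⟩ := (((Metric.tendsto_nhds.mp hμ) (δ / 4) hδ4).and
    ((Metric.tendsto_nhds.mp hε) (δ / 4) hδ4)).exists
  obtain ⟨N₀, hN₀⟩ := (Metric.tendsto_atTop.mp (hg P)) (δ / 4) hδ4
  refine ⟨max N₀ (k + 1), fun N hN => ?_⟩
  have hNk : k + 1 ≤ N := (le_max_right _ _).trans hN
  have h1 := hN₀ N ((le_max_left _ _).trans hN)
  have h2 := happ P N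
  have hN0 : (0 : ℝ) < N := by exact_mod_cast (by omega : 0 < N)
  rw [Real.dist_eq] at *
  rw [sub_zero] at hP2
  have h3 : |(∑ n ∈ Finset.Ioc 0 N, h n) / N - (∑ n ∈ Finset.Ioc 0 N, g P n) / N| ≤
      2 * |ε P| := by
    rw [← sub_div, ← Finset.sum_sub_distrib, abs_div, abs_of_pos hN0, div_le_iff₀ hN0]
    have : (k : ℝ) ≤ N := by exact_mod_cast (by omega : k ≤ N)
    have h4 : (N + k : ℝ) * ε P ≤ (N + k) * |ε P| := by gcongr; exact le_abs_self _
    have h5 : (N + k : ℝ) * |ε P| ≤ (N + N) * |ε P| := by gcongr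
    linarith
  have h6 := abs_sub_le ((∑ n ∈ Finset.Ioc 0 N, h n) / N) ((∑ n ∈ Finset.Ioc 0 N, g P n) / N) m
  have h7 := abs_sub_le ((∑ n ∈ Finset.Ioc 0 N, g P n) / N) (μ P) m
  linarith

/-! ### The ratio `φ(n) / n` and its truncations -/

/-- The ratio `φ(n) / n`. -/
def totientRatio (n : ℕ) : ℝ := n.totient / n

/-- The factor at `p` of the Euler product of `φ(n) / n`. -/
def totientFactor (p n : ℕ) : ℝ := if p ∣ n then 1 - 1 / (p : ℝ) else 1

/-- The sum of the inverses of the prime factors of `n` that are at least `P`. -/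
def primeTail (P n : ℕ) : ℝ := ∑ p ∈ n.primeFactors.filter (P ≤ ·), 1 / (p : ℝ)

theorem one_sub_sum_le_prod {ι : Type*} (s : Finset ι) (x : ι → ℝ) (h0 : ∀ i ∈ s, 0 ≤ x i)
    (h1 : ∀ i ∈ s, x i ≤ 1) : 1 - ∑ i ∈ s, x i ≤ ∏ i ∈ s, (1 - x i) := by
  classical
  induction s using Finset.induction_on with
  | empty => simp
  | insert a s ha ih =>
    have ih := ih (fun i hi => h0 i (Finset.mem_insert_of_mem hi))
      (fun i hi => h1 i (Finset.mem_insert_of_mem hi))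
    have ha0 := h0 a (Finset.mem_insert_self _ _)
    have ha1 := h1 a (Finset.mem_insert_self _ _)
    have hs : 0 ≤ ∑ i ∈ s, x i :=
      Finset.sum_nonneg fun i hi => h0 i (Finset.mem_insert_of_mem hi)
    rw [Finset.sum_insert ha, Finset.prod_insert ha]
    nlinarith [mul_le_mul_of_nonneg_left ih (sub_nonneg.mpr ha1), mul_nonneg ha0 hs]

theorem totientRatio_eq_prod {n : ℕ} (hn : n ≠ 0) :
    totientRatio n = ∏ p ∈ n.primeFactors, (1 - 1 / (p : ℝ)) := by
  have h := Nat.totient_eq_mul_prod_factors n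
  have h' : (n.totient : ℝ) = n * ∏ p ∈ n.primeFactors, (1 - (p : ℝ)⁻¹) := by
    have h2 := congrArg (Rat.cast : ℚ → ℝ) h
    push_cast at h2
    exact h2
  have : (n : ℝ) ≠ 0 := by exact_mod_cast hn
  rw [totientRatio, h', mul_div_cancel_left₀ _ this]
  simp only [one_div]

theorem one_sub_inv_prime_mem {p : ℕ} (hp : p.Prime) :
    0 < 1 - 1 / (p : ℝ) ∧ 1 - 1 / (p : ℝ) < 1 := by
  have h : (1 : ℝ) < p := by exact_mod_cast hp.one_lt
  have h1 : 1 / (p : ℝ) < 1 := by rw [div_lt_one (by linarith)]; exact h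
  have h2 : 0 < 1 / (p : ℝ) := by positivity
  constructor <;> linarith

theorem totientFactor_mem {p : ℕ} (hp : p.Prime) (n : ℕ) :
    0 ≤ totientFactor p n ∧ totientFactor p n ≤ 1 := by
  have := one_sub_inv_prime_mem hp
  unfold totientFactor
  split_ifs
  · exact ⟨this.1.le, this.2.le⟩
  · norm_num

theorem totientRatio_mem (n : ℕ) : 0 ≤ totientRatio n ∧ totientRatio n ≤ 1 := by
  refine ⟨by unfold totientRatio; positivity, ?_⟩
  unfold totientRatio
  exact div_le_one_of_le₀ (by exact_mod_cast Nat.totient_le n) (Nat.cast_nonneg n)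

theorem truncation_mem (P n : ℕ) :
    0 ≤ ∏ p ∈ P.primesBelow, totientFactor p n ∧ ∏ p ∈ P.primesBelow, totientFactor p n ≤ 1 :=
  ⟨Finset.prod_nonneg fun _ hp => (totientFactor_mem (Nat.prime_of_mem_primesBelow hp) n).1,
    Finset.prod_le_one (fun _ hp => (totientFactor_mem (Nat.prime_of_mem_primesBelow hp) n).1)
      fun _ hp => (totientFactor_mem (Nat.prime_of_mem_primesBelow hp) n).2⟩

theorem primeTail_nonneg (P n : ℕ) : 0 ≤ primeTail P n :=
  Finset.sum_nonneg fun _ _ => by positivity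

/-- The truncations of the Euler product of `φ(n) / n` approximate it from above. -/
theorem truncation_sub_totientRatio {n : ℕ} (hn : n ≠ 0) (P : ℕ) :
    0 ≤ ∏ p ∈ P.primesBelow, totientFactor p n - totientRatio n ∧
      ∏ p ∈ P.primesBelow, totientFactor p n - totientRatio n ≤ primeTail P n := by
  set T := ∏ p ∈ P.primesBelow, totientFactor p n with hT
  set U := ∏ p ∈ n.primeFactors.filter (P ≤ ·), (1 - 1 / (p : ℝ)) with hU
  have hprime : ∀ p ∈ n.primeFactors.filter (P ≤ ·), p.Prime := fun p hp =>
    Nat.prime_of_mem_primeFactors (Finset.mem_filter.mp hp).1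
  have hsplit : totientRatio n = T * U := by
    rw [totientRatio_eq_prod hn, ← Finset.prod_filter_not_mul_prod_filter _ (P ≤ ·), hT, hU]
    congr 1
    simp only [totientFactor]
    rw [← Finset.prod_filter]
    refine Finset.prod_congr ?_ fun _ _ => rfl
    ext p
    simp only [Finset.mem_filter, Nat.mem_primeFactors, Nat.mem_primesBelow, not_le]
    tauto
  have hU1 : U ≤ 1 := Finset.prod_le_one (fun p hp => (one_sub_inv_prime_mem (hprime p hp)).1.le)
    fun p hp => (one_sub_inv_prime_mem (hprime p hp)).2.le
  have hU2 : 1 - primeTail P n ≤ U := one_sub_sum_le_prod _ _ (fun _ _ => by positivity)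
    fun p hp => by linarith [(one_sub_inv_prime_mem (hprime p hp)).1]
  obtain ⟨hT0, hT1⟩ := truncation_mem P n
  have hpt := primeTail_nonneg P n
  rw [hsplit]
  constructor <;> nlinarith

theorem sum_primeTail_le (P N : ℕ) :
    ∑ n ∈ Finset.Ioc 0 N, primeTail (P + 1) n ≤ N * (2 / (P + 1)) := by
  have h1 : ∀ n ∈ Finset.Ioc 0 N, primeTail (P + 1) n ≤
      ∑ p ∈ Finset.Ioo P (N + 1), if p ∣ n then 1 / (p : ℝ) else 0 := by
    intro n hn
    rw [Finset.mem_Ioc] at hn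
    rw [← Finset.sum_filter, primeTail]
    refine Finset.sum_le_sum_of_subset_of_nonneg ?_ fun _ _ _ => by positivity
    intro p hp
    simp only [Finset.mem_filter, Nat.mem_primeFactors, Finset.mem_Ioo] at hp ⊢
    have := Nat.le_of_dvd hn.1 hp.1.2.1
    exact ⟨⟨by omega, by omega⟩, hp.1.2.1⟩
  refine (Finset.sum_le_sum h1).trans ?_
  rw [Finset.sum_comm]
  have h2 : ∀ p ∈ Finset.Ioo P (N + 1),
      ∑ n ∈ Finset.Ioc 0 N, (if p ∣ n then 1 / (p : ℝ) else 0) ≤ N * ((p : ℝ) ^ 2)⁻¹ := by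
    intro p _
    rw [← Finset.sum_filter, Finset.sum_const, Nat.Ioc_filter_dvd_card_eq_div, nsmul_eq_mul]
    have : ((N / p : ℕ) : ℝ) ≤ N / p := Nat.cast_div_le
    calc ((N / p : ℕ) : ℝ) * (1 / p) ≤ N / p * (1 / p) := by gcongr
      _ = N * ((p : ℝ) ^ 2)⁻¹ := by ring
  refine (Finset.sum_le_sum h2).trans ?_
  rw [← Finset.mul_sum]
  gcongr
  exact sum_Ioo_inv_sq_le P (N + 1)

theorem sum_primeTail_add_le (P N k : ℕ) :
    ∑ n ∈ Finset.Ioc 0 N, primeTail (P + 1) (n + k) ≤ (N + k) * (2 / (P + 1)) := by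
  have h := sum_primeTail_le P (N + k)
  push_cast at h
  refine le_trans ?_ h
  rw [show ∑ n ∈ Finset.Ioc 0 N, primeTail (P + 1) (n + k) = _ from
    (Finset.sum_map (Finset.Ioc 0 N) (addRightEmbedding k) (primeTail (P + 1))).symm]
  refine Finset.sum_le_sum_of_subset_of_nonneg ?_ fun _ _ _ => primeTail_nonneg _ _
  intro n
  simp only [Finset.mem_map, Finset.mem_Ioc, addRightEmbedding_apply]
  omega

theorem tendsto_two_div_succ : Tendsto (fun P : ℕ => 2 / ((P : ℝ) + 1)) atTop (𝓝 0) := by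
  simpa [Function.comp_def] using
    (tendsto_const_div_atTop_nhds_zero_nat (2 : ℝ)).comp (tendsto_add_atTop_nat 1)

/-! ### The mean values of the products of ratios -/

theorem tendsto_prod_primesBelow {a : ℕ → ℝ} (ha : Multipliable fun p : Nat.Primes => a p) :
    Tendsto (fun P : ℕ => ∏ p ∈ (P + 1).primesBelow, a p) atTop
      (𝓝 (∏' p : Nat.Primes, a p)) := by
  have h := (hasProd_subtype_iff_mulIndicator (s := {p : ℕ | p.Prime}) (f := a)).mp ha.hasProd
  refine ((tendsto_add_atTop_iff_nat 1).mpr h.tendsto_prod_nat).congr fun P => ?_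
  simp only [Set.mulIndicator_apply, Set.mem_ofPred_eq]
  rw [← Finset.prod_filter]
  rfl

theorem summable_primes_of_le {u : Nat.Primes → ℝ} {C : ℝ}
    (hu : ∀ p, |u p| ≤ C / (p : ℝ) ^ 2) : Summable u := by
  have h : Summable fun n : ℕ => C / (n : ℝ) ^ 2 := by
    simpa [div_eq_mul_inv] using (Real.summable_nat_pow_inv.mpr one_lt_two).mul_left C
  exact Summable.of_norm_bounded (h.comp_injective Subtype.val_injective) hu

/-- The mean over the multiples of `b` of an arithmetic function which is an infinite product of
local factors, with the truncation error controlled by the large prime factors of `n` and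
`n + k`. -/
theorem hasMean_of_truncation {b : ℕ} (hb : 0 < b) (k : ℕ) {f : ℕ → ℕ → ℝ} {a : ℕ → ℝ}
    {F : ℕ → ℝ}
    (h1 : ∀ p : ℕ, p.Prime → ¬ p ∣ b → PeriodicMean (f p) p (a p))
    (h2 : ∀ p : ℕ, p.Prime → p ∣ b → ∀ n, b ∣ n → f p n = a p)
    (ha : Multipliable fun p : Nat.Primes => a p)
    (hF : ∀ P n : ℕ, n ≠ 0 → |F n - ∏ p ∈ P.primesBelow, f p n| ≤
      primeTail P n + primeTail P (n + k)) :
    HasMean (fun n => if b ∣ n then F n else 0) (1 / b * ∏' p : Nat.Primes, a p) := by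
  have hε : Tendsto (fun P : ℕ => 2 * (2 / ((P : ℝ) + 1))) atTop (𝓝 0) := by
    simpa using tendsto_two_div_succ.const_mul 2
  refine HasMean.of_approx k
    (g := fun P n => if b ∣ n then ∏ p ∈ (P + 1).primesBelow, f p n else 0)
    (fun P => (periodicMean_prod hb (P + 1).primesBelow
      (fun p hp => Nat.prime_of_mem_primesBelow hp)
      (fun p hp => h1 p (Nat.prime_of_mem_primesBelow hp))
      (fun p hp => h2 p (Nat.prime_of_mem_primesBelow hp))).hasMean)
    ((tendsto_prod_primesBelow ha).const_mul _) hε fun P N => ?_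
  refine (Finset.abs_sum_le_sum_abs _ _).trans ?_
  calc _ ≤ ∑ n ∈ Finset.Ioc 0 N, (primeTail (P + 1) n + primeTail (P + 1) (n + k)) := by
        refine Finset.sum_le_sum fun n hn => ?_
        split_ifs
        · exact hF _ _ (Finset.mem_Ioc.mp hn).1.ne'
        · rw [sub_self, abs_zero]
          exact add_nonneg (primeTail_nonneg _ _) (primeTail_nonneg _ _)
    _ ≤ N * (2 / (P + 1)) + (N + k) * (2 / (P + 1)) := by
        rw [Finset.sum_add_distrib]
        exact add_le_add (sum_primeTail_le P N) (sum_primeTail_add_le P N k)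
    _ ≤ (N + k) * (2 * (2 / (P + 1))) := by
        have : (0 : ℝ) ≤ k * (2 / (P + 1)) := by positivity
        nlinarith

theorem totientFactor_eq (p n : ℕ) :
    totientFactor p n = 1 + -(1 / (p : ℝ)) * if p ∣ n then 1 else 0 := by
  unfold totientFactor
  split_ifs <;> ring

theorem periodicMean_totientFactor {p : ℕ} (hp : 0 < p) :
    PeriodicMean (totientFactor p) p (1 - 1 / (p : ℝ) ^ 2) := by
  convert (periodicMean_const hp 1).add ((periodicMean_dvd hp).const_mul (-(1 / (p : ℝ)))) using 1
  · exact funext (totientFactor_eq p)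
  · ring

theorem periodicMean_totientFactor_mul {p : ℕ} (hp : 0 < p) (k : ℕ) :
    PeriodicMean (fun n => totientFactor p n * totientFactor p (n + k)) p
      (1 - 2 / (p : ℝ) ^ 2 + if p ∣ k then 1 / (p : ℝ) ^ 3 else 0) := by
  have h1 := (periodicMean_totientFactor hp).add
    (((periodicMean_dvd hp).shift k).const_mul (-(1 / (p : ℝ))))
  have h2 := h1.add (((periodicMean_dvd hp).const_mul (if p ∣ k then 1 / (p : ℝ) ^ 2 else 0)))
  convert h2 using 1
  · funext n
    have : p ∣ n → (p ∣ n + k ↔ p ∣ k) := fun h => (Nat.dvd_add_iff_right h).symm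
    simp only [totientFactor]
    by_cases hn : p ∣ n
    · simp only [hn, this hn, if_true]
      split_ifs <;> ring
    · simp only [hn, if_false]
      split_ifs <;> ring
  · split_ifs <;> ring

/-- The ratio `φ(n) / n` has a positive mean over the multiples of `b`. -/
theorem exists_hasMean_totientRatio {b : ℕ} (hb : 0 < b) :
    ∃ m : ℝ, 0 < m ∧ HasMean (fun n => if b ∣ n then totientRatio n else 0) m := by
  set a : ℕ → ℝ := fun p => if p ∣ b then 1 - 1 / (p : ℝ) else 1 - 1 / (p : ℝ) ^ 2 with ha
  have hpos : ∀ p : Nat.Primes, 0 < a p := by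
    intro p
    have h := one_sub_inv_prime_mem p.2
    simp only [ha]
    split_ifs
    · exact h.1
    · have h1 : 1 / (p : ℝ) ^ 2 = (1 / (p : ℝ)) ^ 2 := by ring
      rw [h1]
      nlinarith
  have hsum : Summable fun p : Nat.Primes => a p - 1 := by
    refine summable_primes_of_le (C := b) fun p => ?_
    have hp0 : (0 : ℝ) < (p : ℕ) := by exact_mod_cast p.2.pos
    have hb1 : (1 : ℝ) ≤ b := by exact_mod_cast hb
    simp only [ha]
    split_ifs with h
    · have : ((p : ℕ) : ℝ) ≤ b := by exact_mod_cast Nat.le_of_dvd hb h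
      rw [show 1 - 1 / ((p : ℕ) : ℝ) - 1 = -(1 / ((p : ℕ) : ℝ)) by ring, abs_neg,
        abs_of_pos (by positivity), div_le_div_iff₀ hp0 (by positivity)]
      nlinarith
    · rw [show 1 - 1 / ((p : ℕ) : ℝ) ^ 2 - 1 = -(1 / ((p : ℕ) : ℝ) ^ 2) by ring, abs_neg,
        abs_of_pos (by positivity)]
      gcongr
  have hlog : Summable fun p : Nat.Primes => Real.log (a p) := by
    simpa using Real.summable_log_one_add_of_summable hsum
  refine ⟨1 / b * ∏' p : Nat.Primes, a p, ?_, ?_⟩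
  · rw [← Real.rexp_tsum_eq_tprod hpos hlog]
    positivity
  · refine hasMean_of_truncation hb 0 (f := totientFactor) (a := a) (fun p hp hpb => ?_)
      (fun p _ hpb n hn => ?_) (Real.multipliable_of_summable_log hpos hlog) fun P n hn => ?_
    · simpa [ha, hpb] using periodicMean_totientFactor hp.pos
    · simp [ha, hpb, totientFactor, hpb.trans hn]
    · have h := truncation_sub_totientRatio hn P
      rw [abs_sub_comm, abs_of_nonneg h.1]
      linarith [h.2, primeTail_nonneg P (n + 0)]

/-- Mirsky's mean value of `φ(n) φ(n + k) / (n (n + k))` over the multiples of `b`. -/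
theorem hasMean_totientRatio_mul {b k : ℕ} (hb : 0 < b) (hbk : b ∣ k) :
    HasMean (fun n => if b ∣ n then totientRatio n * totientRatio (n + k) else 0)
      (mirskyConst b b k) := by
  have hg1 : ∀ p : ℕ, p.gcd b ∣ k + b := fun p =>
    ((p.gcd_dvd_right b).trans hbk).add (p.gcd_dvd_right b)
  have hg2 : ∀ p : ℕ, p.gcd b ∣ b + k := fun p => add_comm k b ▸ hg1 p
  set A : ℕ → ℝ := fun p => 1 - (Nat.gcd p b : ℝ) / (p : ℝ) ^ 2 with hA
  set B : ℕ → ℝ := fun p =>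
    1 - (Nat.gcd p b : ℝ) * (kappa b b k p * kappa' k p / (p : ℝ) ^ 2) with hB
  have hconst : mirskyConst b b k =
      1 / b * (∏' p : Nat.Primes, A p) * ∏' p : Nat.Primes, B p := by
    unfold mirskyConst
    simp only [hg1, Nat.gcd_dvd_right, if_true, hA, hB]
  have hgb : ∀ p : ℕ, (Nat.gcd p b : ℝ) ≤ b := fun p => by
    exact_mod_cast Nat.le_of_dvd hb (Nat.gcd_dvd_right p b)
  have hkappa : ∀ p : ℕ, kappa b b k p = (A p)⁻¹ := fun p => if_pos (hg2 p)
  have hApos : ∀ p : ℕ, p.Prime → 1 / 2 ≤ A p := by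
    intro p hp
    have h2 : (2 : ℝ) ≤ p := by exact_mod_cast hp.two_le
    have : (Nat.gcd p b : ℝ) ≤ p := by exact_mod_cast Nat.le_of_dvd hp.pos (Nat.gcd_dvd_left p b)
    have h3 : (Nat.gcd p b : ℝ) / (p : ℝ) ^ 2 ≤ 1 / 2 := by
      rw [div_le_div_iff₀ (by positivity) two_pos]
      nlinarith
    simp only [hA]
    linarith
  have hkappa' : ∀ p : ℕ, p.Prime → 0 ≤ kappa' k p ∧ kappa' k p ≤ 1 := fun p hp =>
    totientFactor_mem hp k
  have hAm : Multipliable fun p : Nat.Primes => A p := by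
    have : Summable fun p : Nat.Primes => -((Nat.gcd p b : ℝ) / ((p : ℕ) : ℝ) ^ 2) := by
      refine summable_primes_of_le (C := b) fun p => ?_
      rw [abs_neg, abs_of_nonneg (by positivity)]
      gcongr
      exact_mod_cast hgb p
    simpa only [← sub_eq_add_neg] using Real.multipliable_one_add_of_summable this
  have hBm : Multipliable fun p : Nat.Primes => B p := by
    have : Summable fun p : Nat.Primes =>
        -((Nat.gcd p b : ℝ) * (kappa b b k p * kappa' k p / ((p : ℕ) : ℝ) ^ 2)) := by
      refine summable_primes_of_le (C := b * 2) fun p => ?_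
      obtain ⟨h0, h1⟩ := hkappa' p p.2
      have h2 : 0 ≤ kappa b b k p ∧ kappa b b k p ≤ 2 := by
        rw [hkappa]
        have := hApos p p.2
        refine ⟨inv_nonneg.mpr (by linarith), ?_⟩
        exact (inv_anti₀ (by norm_num) this).trans (by norm_num)
      have h2' := h2.1
      rw [abs_neg, abs_of_nonneg (by positivity), ← mul_div_assoc]
      have h3 : kappa b b k p * kappa' k p ≤ 2 * 1 :=
        mul_le_mul h2.2 h1 h0 (by norm_num)
      have h4 : (Nat.gcd p b : ℝ) * (kappa b b k p * kappa' k p) ≤ b * (2 * 1) :=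
        mul_le_mul (hgb p) h3 (by positivity) (by positivity)
      exact div_le_div_of_nonneg_right (by linarith) (by positivity)
    simpa only [← sub_eq_add_neg] using Real.multipliable_one_add_of_summable this
  rw [hconst, mul_assoc, ← hAm.tprod_mul hBm]
  -- The factor `κ` is the inverse of the factor of the first product, since `b ∣ k`.
  have hAB : ∀ p : ℕ, p.Prime → A p * B p = A p - (Nat.gcd p b : ℝ) * kappa' k p / (p : ℝ) ^ 2 := by
    intro p hp
    have h1 : A p ≠ 0 := by linarith [hApos p hp]
    simp only [hB, hkappa]
    rw [mul_sub, mul_one]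
    congr 1
    field_simp
  refine hasMean_of_truncation hb k (a := fun p => A p * B p)
    (f := fun p n => totientFactor p n * totientFactor p (n + k))
    (fun p hp hpb => ?_) (fun p hp hpb n hn => ?_) (hAm.mul hBm) fun P n hn => ?_
  · have hg : p.gcd b = 1 := hp.coprime_iff_not_dvd.mpr hpb
    convert periodicMean_totientFactor_mul hp.pos k using 1
    rw [hAB p hp]
    simp only [hA, hg, kappa']
    split_ifs <;> push_cast <;> ring
  · have hg : p.gcd b = p := Nat.gcd_eq_left hpb
    have hpn := hpb.trans hn
    have hpk := hpb.trans hbk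
    have hp0 : (p : ℝ) ≠ 0 := by exact_mod_cast hp.ne_zero
    rw [hAB p hp]
    simp only [hA, hg, kappa', totientFactor, hpn, hpk, hpn.add hpk, if_true]
    field_simp
  · obtain ⟨h1, h2⟩ := truncation_sub_totientRatio hn P
    obtain ⟨h3, h4⟩ := truncation_sub_totientRatio (show n + k ≠ 0 by omega) P
    obtain ⟨h5, h6⟩ := totientRatio_mem n
    obtain ⟨h7, h8⟩ := truncation_mem P (n + k)
    rw [Finset.prod_mul_distrib, abs_sub_comm]
    set T := ∏ p ∈ P.primesBelow, totientFactor p n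
    set T' := ∏ p ∈ P.primesBelow, totientFactor p (n + k)
    have he : T * T' - totientRatio n * totientRatio (n + k) =
        (T - totientRatio n) * T' + totientRatio n * (T' - totientRatio (n + k)) := by ring
    rw [he, abs_of_nonneg (by positivity)]
    exact add_le_add ((mul_le_of_le_one_right h1 h8).trans h2)
      ((mul_le_of_le_one_left h3 h6).trans h4)

/-! ### Weighted Riemann sums -/

/-- The Riemann sums of `g` over `[0, 1]`, weighted by the arithmetic function `h`, converge
to `m` times the integral of `g`. -/
structure RiemannTendsto (h : ℕ → ℝ) (m : ℝ) (g : ℝ → ℂ) : Prop where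
  integrable : IntervalIntegrable g volume 0 1
  tendsto : Tendsto (fun N : ℕ => (∑ n ∈ Finset.Ioc 0 N, (h n : ℂ) * g (n / N)) / N) atTop
    (𝓝 (m * ∫ t in (0 : ℝ)..1, g t))

theorem RiemannTendsto.const_mul {h : ℕ → ℝ} {m : ℝ} {g : ℝ → ℂ} (hg : RiemannTendsto h m g)
    (c : ℂ) : RiemannTendsto h m (fun t => c * g t) := by
  refine ⟨hg.integrable.const_mul c, ?_⟩
  have := hg.tendsto.const_mul c
  rw [intervalIntegral.integral_const_mul, mul_left_comm]
  refine this.congr fun N => ?_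
  rw [← mul_div_assoc, Finset.mul_sum]
  simp only [mul_left_comm]

theorem RiemannTendsto.sub {h : ℕ → ℝ} {m : ℝ} {g g' : ℝ → ℂ} (hg : RiemannTendsto h m g)
    (hg' : RiemannTendsto h m g') : RiemannTendsto h m (fun t => g t - g' t) := by
  refine ⟨hg.integrable.sub hg'.integrable, ?_⟩
  have := hg.tendsto.sub hg'.tendsto
  rw [intervalIntegral.integral_sub hg.integrable hg'.integrable, mul_sub]
  refine this.congr fun N => ?_
  rw [← sub_div, ← Finset.sum_sub_distrib]
  simp only [mul_sub]

theorem RiemannTendsto.sum {h : ℕ → ℝ} {m : ℝ} {ι : Type*} (s : Finset ι) {g : ι → ℝ → ℂ}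
    (hg : ∀ i ∈ s, RiemannTendsto h m (g i)) : RiemannTendsto h m (fun t => ∑ i ∈ s, g i t) := by
  refine ⟨by
    simpa [Finset.sum_fn] using IntervalIntegrable.sum s fun i hi => (hg i hi).integrable, ?_⟩
  have := tendsto_finsetSum s fun i hi => (hg i hi).tendsto
  rw [intervalIntegral.integral_finsetSum fun i hi => (hg i hi).integrable, Finset.mul_sum]
  refine this.congr fun N => ?_
  rw [← Finset.sum_div, Finset.sum_comm]
  simp only [Finset.mul_sum]

theorem riemannTendsto_indicator {h : ℕ → ℝ} {m : ℝ} (hm : HasMean h m) {x : ℝ} (hx0 : 0 ≤ x)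
    (hx1 : x ≤ 1) : RiemannTendsto h m ((Set.Iic x).indicator fun _ => 1) := by
  have hint : IntervalIntegrable ((Set.Iic x).indicator fun _ => (1 : ℂ)) volume 0 1 := by
    rw [intervalIntegrable_iff]
    exact (integrableOn_const (by simp)).indicator measurableSet_Iic
  refine ⟨hint, ?_⟩
  have hI : ∫ t in (0 : ℝ)..1, (Set.Iic x).indicator (fun _ => (1 : ℂ)) t = x := by
    rw [intervalIntegral.integral_of_le zero_le_one, setIntegral_indicator measurableSet_Iic,
      Set.Ioc_inter_Iic, min_eq_right hx1]
    simp [hx0]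
  rw [hI]
  have hfl : Tendsto (fun N : ℕ => ((⌊x * N⌋₊ : ℕ) : ℝ) / N) atTop (𝓝 x) :=
    (tendsto_nat_floor_mul_div_atTop hx0).comp tendsto_natCast_atTop_atTop
  have key : Tendsto (fun N : ℕ => (∑ n ∈ Finset.Ioc 0 ⌊x * N⌋₊, h n) / N) atTop
      (𝓝 (m * x)) := by
    rcases hx0.eq_or_lt with rfl | hx
    · simp
    · have h1 : Tendsto (fun N : ℕ => ⌊x * N⌋₊) atTop atTop :=
        tendsto_nat_floor_atTop.comp (tendsto_natCast_atTop_atTop.const_mul_atTop hx)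
      refine ((hm.comp h1).mul hfl).congr' ?_
      filter_upwards [h1.eventually_gt_atTop 0] with N hN
      have : ((⌊x * N⌋₊ : ℕ) : ℝ) ≠ 0 := by positivity
      simp only [Function.comp_apply]
      field_simp
  have key' := (Complex.continuous_ofReal.tendsto _).comp key
  rw [Complex.ofReal_mul] at key'
  refine key'.congr' ?_
  filter_upwards [eventually_gt_atTop 0] with N hN
  have hN0 : (0 : ℝ) < N := by exact_mod_cast hN
  simp only [Function.comp_apply]
  push_cast
  congr 1
  simp only [Set.indicator_apply, Set.mem_Iic, mul_ite, mul_one, mul_zero]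
  rw [← Finset.sum_filter]
  refine Finset.sum_congr ?_ fun _ _ => rfl
  ext n
  simp only [Finset.mem_Ioc, Finset.mem_filter]
  rw [div_le_iff₀ hN0, Nat.le_floor_iff (by positivity)]
  refine ⟨fun hn => ⟨⟨hn.1, ?_⟩, hn.2⟩, fun hn => ⟨hn.1.1, hn.2⟩⟩
  have : (n : ℝ) ≤ N := hn.2.trans (mul_le_of_le_one_left hN0.le hx1)
  exact_mod_cast this

theorem norm_weighted_sum_le {h : ℕ → ℝ} (h0 : ∀ n, 0 ≤ h n) (h1 : ∀ n, h n ≤ 1) {u : ℕ → ℂ}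
    {N : ℕ} {ε : ℝ} (hε : 0 ≤ ε) (hu : ∀ n ∈ Finset.Ioc 0 N, ‖u n‖ ≤ ε) :
    ‖(∑ n ∈ Finset.Ioc 0 N, (h n : ℂ) * u n) / N‖ ≤ ε := by
  rw [norm_div, Complex.norm_natCast]
  refine div_le_of_le_mul₀ (Nat.cast_nonneg N) hε ((norm_sum_le _ _).trans ?_)
  refine (Finset.sum_le_card_nsmul _ _ ε fun n hn => ?_).trans ?_
  · rw [norm_mul, Complex.norm_real, Real.norm_of_nonneg (h0 n)]
    exact (mul_le_of_le_one_left (norm_nonneg _) (h1 n)).trans (hu n hn)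
  · simp [mul_comm]

theorem tendsto_of_forall_approx {u : ℕ → ℂ} {a : ℂ}
    (H : ∀ ε > 0, ∃ (v : ℕ → ℂ) (b : ℂ), Tendsto v atTop (𝓝 b) ∧ ‖a - b‖ ≤ ε ∧
      ∀ᶠ N in atTop, ‖u N - v N‖ ≤ ε) : Tendsto u atTop (𝓝 a) := by
  rw [Metric.tendsto_nhds]
  intro ε hε
  obtain ⟨v, b, hv, hab, huv⟩ := H (ε / 4) (by positivity)
  filter_upwards [huv, (Metric.tendsto_nhds.mp hv) (ε / 4) (by positivity)] with N h1 h2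
  rw [dist_eq_norm] at *
  calc ‖u N - a‖ = ‖(u N - v N) + (v N - b) - (a - b)‖ := by congr 1; ring
    _ ≤ ‖u N - v N‖ + ‖v N - b‖ + ‖a - b‖ :=
      (norm_sub_le _ _).trans (by gcongr; exact norm_add_le _ _)
    _ < ε := by linarith

theorem HasMean.abs_le {h : ℕ → ℝ} {m : ℝ} (hm : HasMean h m) (h0 : ∀ n, 0 ≤ h n)
    (h1 : ∀ n, h n ≤ 1) : |m| ≤ 1 := by
  refine le_of_tendsto hm.abs (Eventually.of_forall fun N => ?_)
  have hs : 0 ≤ ∑ n ∈ Finset.Ioc 0 N, h n := Finset.sum_nonneg fun n _ => h0 n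
  rw [abs_of_nonneg (by positivity)]
  refine div_le_one_of_le₀ ?_ (Nat.cast_nonneg N)
  simpa using Finset.sum_le_card_nsmul (Finset.Ioc 0 N) h 1 fun n _ => h1 n

theorem RiemannTendsto.of_approx {h : ℕ → ℝ} {m : ℝ} (hm : HasMean h m) (h0 : ∀ n, 0 ≤ h n)
    (h1 : ∀ n, h n ≤ 1) {g : ℝ → ℂ} (hg : IntervalIntegrable g volume 0 1)
    (H : ∀ ε > 0, ∃ g', RiemannTendsto h m g' ∧ ∀ t ∈ Set.Ioc (0 : ℝ) 1, ‖g t - g' t‖ ≤ ε) :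
    RiemannTendsto h m g := by
  refine ⟨hg, tendsto_of_forall_approx fun ε hε => ?_⟩
  obtain ⟨g', hg', hd⟩ := H ε hε
  refine ⟨_, _, hg'.tendsto, ?_, Eventually.of_forall fun N => ?_⟩
  · rw [← mul_sub, ← intervalIntegral.integral_sub hg hg'.integrable, norm_mul, Complex.norm_real]
    have := intervalIntegral.norm_integral_le_of_norm_le_const (a := (0 : ℝ)) (b := 1)
      (f := fun t => g t - g' t) (C := ε) (by simpa [Set.uIoc_of_le zero_le_one] using hd)
    calc _ ≤ 1 * (ε * |1 - 0|) := by gcongr; exact hm.abs_le h0 h1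
      _ = ε := by simp
  · rw [← sub_div, ← Finset.sum_sub_distrib]
    simp only [← mul_sub]
    refine norm_weighted_sum_le h0 h1 hε.le fun n hn => hd _ ?_
    rw [Finset.mem_Ioc] at hn
    have hN : (0 : ℝ) < N := by exact_mod_cast hn.1.trans_le hn.2
    have hn0 : (0 : ℝ) < n := by exact_mod_cast hn.1
    exact ⟨by positivity, (div_le_one hN).mpr (by exact_mod_cast hn.2)⟩

/-- Riemann sums of continuous functions weighted by an arithmetic function with a mean: the
indicator functions of intervals are the definition of the mean, and step functions are uniformly
dense. -/
theorem riemannTendsto_of_continuousOn {h : ℕ → ℝ} {m : ℝ} (hm : HasMean h m)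
    (h0 : ∀ n, 0 ≤ h n) (h1 : ∀ n, h n ≤ 1) {g : ℝ → ℂ} (hg : ContinuousOn g (Set.Icc 0 1)) :
    RiemannTendsto h m g := by
  refine RiemannTendsto.of_approx hm h0 h1
    (hg.intervalIntegrable_of_Icc zero_le_one) fun ε hε => ?_
  obtain ⟨δ, hδ, hunif⟩ := Metric.uniformContinuousOn_iff.mp
    (isCompact_Icc.uniformContinuousOn_of_continuous hg) ε hε
  obtain ⟨J, hJ⟩ := exists_nat_one_div_lt hδ
  have hJ0 : (0 : ℝ) < J + 1 := by positivity
  -- The step function is `g (j / (J + 1))` on the interval `(j / (J + 1), (j + 1) / (J + 1)]`.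
  set c : ℕ → ℝ := fun j => j / (J + 1) with hc
  have hcmem : ∀ j ≤ J + 1, c j ∈ Set.Icc (0 : ℝ) 1 := fun j hj =>
    ⟨by positivity, (div_le_one hJ0).mpr (by exact_mod_cast hj)⟩
  set I : ℕ → ℝ → ℂ := fun j => (Set.Iic (c j)).indicator fun _ => 1 with hI
  refine ⟨fun t => ∑ j ∈ Finset.range (J + 1), g (c j) * (I (j + 1) t - I j t),
    RiemannTendsto.sum _ fun j hj => ?_, fun t ht => ?_⟩
  · rw [Finset.mem_range] at hj
    have ha := hcmem j (by omega)
    have hb := hcmem (j + 1) (by omega)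
    exact ((riemannTendsto_indicator hm hb.1 hb.2).sub
      (riemannTendsto_indicator hm ha.1 ha.2)).const_mul _
  · have hdiff : ∀ j, I (j + 1) t - I j t = (((Set.Ioc (c j) (c (j + 1))).indicator
        (fun _ => (1 : ℝ)) t : ℝ) : ℂ) := by
      intro j
      have hle : c j ≤ c (j + 1) := by simp only [hc]; gcongr; simp
      simp only [hI, Set.indicator_apply, Set.mem_Iic, Set.mem_Ioc]
      by_cases h2 : t ≤ c j
      · simp [h2, h2.trans hle, not_lt.mpr h2]
      · by_cases h3 : t ≤ c (j + 1)
        · simp [h2, h3, not_le.mp h2]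
        · simp [h2, h3]
    have htel : ∑ j ∈ Finset.range (J + 1), (I (j + 1) t - I j t) = 1 := by
      rw [Finset.sum_range_sub fun j => I j t]
      have e1 : c (J + 1) = 1 := by simp only [hc]; push_cast; exact div_self hJ0.ne'
      have e0 : c 0 = 0 := by simp [hc]
      simp [hI, e1, e0, ht.2, ht.1]
    have hsum1 : ∑ j ∈ Finset.range (J + 1), (Set.Ioc (c j) (c (j + 1))).indicator
        (fun _ => (1 : ℝ)) t = 1 := by
      simp only [hdiff] at htel
      exact_mod_cast htel
    have hgt : g t = ∑ j ∈ Finset.range (J + 1), g t * (I (j + 1) t - I j t) := by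
      rw [← Finset.mul_sum, htel, mul_one]
    rw [hgt, ← Finset.sum_sub_distrib]
    simp only [← sub_mul, hdiff]
    calc _ ≤ ∑ j ∈ Finset.range (J + 1),
          ε * (Set.Ioc (c j) (c (j + 1))).indicator (fun _ => (1 : ℝ)) t := by
          refine (norm_sum_le _ _).trans (Finset.sum_le_sum fun j hj => ?_)
          rw [Finset.mem_range] at hj
          rw [norm_mul, Complex.norm_real]
          by_cases h2 : t ∈ Set.Ioc (c j) (c (j + 1))
          · simp only [h2, Set.indicator_of_mem, norm_one, mul_one]
            rw [← dist_eq_norm]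
            refine (hunif t ⟨ht.1.le, ht.2⟩ (c j) (hcmem j (by omega)) ?_).le
            rw [Real.dist_eq, abs_of_pos (by linarith [h2.1])]
            have : c (j + 1) = c j + 1 / (J + 1) := by simp only [hc]; push_cast; ring
            linarith [h2.2]
          · simp [h2]
      _ = ε := by rw [← Finset.mul_sum, hsum1, mul_one]

/-- Weighted Riemann sums of a sequence of functions that converges uniformly on the sample
points to a continuous function. -/
theorem tendsto_weighted_riemann_sum {h : ℕ → ℝ} {m : ℝ} (hm : HasMean h m)
    (h0 : ∀ n, 0 ≤ h n) (h1 : ∀ n, h n ≤ 1) {g : ℝ → ℂ} (hg : ContinuousOn g (Set.Icc 0 1))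
    {G : ℕ → ℕ → ℂ}
    (hG : ∀ ε > 0, ∀ᶠ N : ℕ in atTop, ∀ n ∈ Finset.Ioc 0 N, ‖G N n - g (n / N)‖ ≤ ε) :
    Tendsto (fun N : ℕ => (∑ n ∈ Finset.Ioc 0 N, (h n : ℂ) * G N n) / N) atTop
      (𝓝 (m * ∫ t in (0 : ℝ)..1, g t)) := by
  refine tendsto_of_forall_approx fun ε hε => ⟨_, _,
    (riemannTendsto_of_continuousOn hm h0 h1 hg).tendsto, by simp [hε.le], ?_⟩
  filter_upwards [hG ε hε] with N hN
  rw [← sub_div, ← Finset.sum_sub_distrib]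
  simp only [← mul_sub]
  exact norm_weighted_sum_le h0 h1 hε.le hN

/-! ### The translates of the horoball -/

/-- The translate of the horoball at infinity that is tangent to the real line at `a / c`, for
coprime `a` and `c`, and the horoball itself if `c = 0`. -/
def horoballAt (a c : ℤ) : Set ℍ :=
  {z | (c * z.re - a) ^ 2 + (c * z.im) ^ 2 ≤ z.im}

theorem im_smul_eq (g : SL(2, ℤ)) (z : ℍ) :
    (g • z).im = z.im / ((g 1 0 * z.re + g 1 1) ^ 2 + (g 1 0 * z.im) ^ 2) := by
  have h := UpperHalfPlane.coe_specialLinearGroup_apply g z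
  have hdet : (g 0 0 : ℝ) * g 1 1 - g 0 1 * g 1 0 = 1 := by
    have := g.det_coe
    rw [Matrix.det_fin_two] at this
    exact_mod_cast this
  have him := congrArg Complex.im h
  rw [UpperHalfPlane.coe_im] at him
  rw [him, Complex.div_im]
  simp [Complex.normSq_apply]
  rw [← sub_div, sq, sq]
  congr 1
  linear_combination z.im * hdet

theorem denom_sq_pos (g : SL(2, ℤ)) (z : ℍ) :
    0 < (g 1 0 * z.re + g 1 1 : ℝ) ^ 2 + (g 1 0 * z.im) ^ 2 := by
  have h1 := (g • z).im_pos
  rw [im_smul_eq] at h1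
  exact (div_pos_iff_of_pos_left z.im_pos).mp h1

theorem inv_smul_mem_horoball (g : SL(2, ℤ)) (z : ℍ) :
    g⁻¹ • z ∈ horoball ↔ z ∈ horoballAt (g 0 0) (g 1 0) := by
  have h := denom_sq_pos g⁻¹ z
  simp only [horoball, horoballAt, Set.mem_ofPred_eq]
  rw [im_smul_eq, one_le_div h]
  simp [Matrix.SpecialLinearGroup.SL2_inv_expl]
  ring_nf

theorem exists_matrix {b : ℕ} (γ : heckeGroup b) : ∃ g : SL(2, ℤ), (b : ℤ) ∣ g 1 0 ∧
    (γ : ModularGroup) = QuotientGroup.mk' (Subgroup.center SL(2, ℤ)) g := by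
  obtain ⟨g, hg, he⟩ := Subgroup.mem_map.mp γ.2
  exact ⟨g, (ZMod.intCast_zmod_eq_zero_iff_dvd _ _).mp (CongruenceSubgroup.Gamma0_mem.mp hg),
    he.symm⟩

theorem smul_eq_of_coe_eq {b : ℕ} {γ : heckeGroup b} {g : SL(2, ℤ)}
    (h : (γ : ModularGroup) = QuotientGroup.mk' (Subgroup.center SL(2, ℤ)) g) (z : ℍ) :
    γ • z = g • z := by
  rw [← mk_smul, ← h]
  rfl

/-- The class in `Γ₀[b]` of a matrix. -/
def heckeMk {b : ℕ} (g : SL(2, ℤ)) (hg : (b : ℤ) ∣ g 1 0) : heckeGroup b :=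
  ⟨QuotientGroup.mk' (Subgroup.center SL(2, ℤ)) g, Subgroup.mem_map_of_mem _
    (CongruenceSubgroup.Gamma0_mem.mpr ((ZMod.intCast_zmod_eq_zero_iff_dvd _ _).mpr hg))⟩

theorem heckeMk_smul {b : ℕ} (g : SL(2, ℤ)) (hg : (b : ℤ) ∣ g 1 0) (z : ℍ) :
    heckeMk g hg • z = g • z :=
  smul_eq_of_coe_eq rfl z

theorem smul_horoball_eq {b : ℕ} {γ : heckeGroup b} {g : SL(2, ℤ)}
    (h : (γ : ModularGroup) = QuotientGroup.mk' (Subgroup.center SL(2, ℤ)) g) :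
    γ • horoball = horoballAt (g 0 0) (g 1 0) := by
  ext z
  rw [Set.mem_smul_set_iff_inv_smul_mem, ← inv_smul_mem_horoball,
    smul_eq_of_coe_eq (γ := γ⁻¹) (g := g⁻¹) (by rw [Subgroup.coe_inv, h, map_inv])]

theorem horoballAt_neg (a c : ℤ) : horoballAt (-a) (-c) = horoballAt a c := by
  ext z
  simp only [horoballAt, Set.mem_ofPred_eq]
  push_cast
  ring_nf

theorem horoballAt_zero {a : ℤ} (ha : IsUnit a) : horoballAt a 0 = horoball := by
  ext z
  rcases Int.isUnit_iff.mp ha with rfl | rfl <;> simp [horoballAt, horoball]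

theorem isCoprime_column (g : SL(2, ℤ)) : IsCoprime (g 0 0) (g 1 0) := by
  refine ⟨g 1 1, -g 0 1, ?_⟩
  have := g.det_coe
  rw [Matrix.det_fin_two] at this
  linarith

/-- The translates of the horoball by `Γ₀[b]` are itself and the horoballs at the rational
numbers `a / c` in lowest terms with `b ∣ c`. -/
theorem smul_horoball_cases {b : ℕ} (γ : heckeGroup b) :
    γ • horoball = horoball ∨ ∃ (a : ℤ) (c : ℕ), 0 < c ∧ b ∣ c ∧ IsCoprime a (c : ℤ) ∧
      γ • horoball = horoballAt a c := by
  obtain ⟨g, hb, hg⟩ := exists_matrix γ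
  rw [smul_horoball_eq hg]
  have hco := isCoprime_column g
  rcases lt_trichotomy (g 1 0) 0 with h | h | h
  · refine Or.inr ⟨-g 0 0, (g 1 0).natAbs, by omega, by rwa [← Int.natCast_dvd], ?_, ?_⟩
    · rw [show ((g 1 0).natAbs : ℤ) = -g 1 0 by omega]
      exact hco.neg_neg
    · rw [show ((g 1 0).natAbs : ℤ) = -g 1 0 by omega, horoballAt_neg]
  · rw [h] at hco ⊢
    exact Or.inl (horoballAt_zero (isCoprime_zero_right.mp hco))
  · refine Or.inr ⟨g 0 0, (g 1 0).natAbs, by omega, by rwa [← Int.natCast_dvd], ?_, ?_⟩ <;>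
    rw [show ((g 1 0).natAbs : ℤ) = g 1 0 by omega]
    exact hco

theorem exists_smul_horoball {b : ℕ} {a c : ℤ} (hbc : (b : ℤ) ∣ c) (hac : IsCoprime a c) :
    ∃ γ : heckeGroup b, γ • horoball = horoballAt a c := by
  obtain ⟨u, v, huv⟩ := hac
  let g : SL(2, ℤ) := ⟨!![a, -v; c, u], by rw [Matrix.det_fin_two_of]; linarith⟩
  exact ⟨heckeMk g hbc, smul_horoball_eq (g := g) rfl⟩

/-! ### Shortest arcs between horoballs -/

/-- The geodesic arc from the horoball at infinity to the horoball at `a / c`, contained in the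
vertical line over `a / c`. -/
def footArc (a : ℤ) (c : ℕ) (hc : 0 < c) : ℍ × ℍ :=
  (⟨⟨a / c, 1⟩, one_pos⟩, ⟨⟨a / c, 1 / (c : ℝ) ^ 2⟩, by positivity⟩)

theorem dist_footArc (a : ℤ) {c : ℕ} (hc : 0 < c) :
    dist (footArc a c hc).1 (footArc a c hc).2 = 2 * Real.log c := by
  rw [UpperHalfPlane.dist_of_re_eq
    (show (footArc a c hc).1.re = (footArc a c hc).2.re from rfl)]
  have h1 : (footArc a c hc).1.im = 1 := rfl
  have h2 : (footArc a c hc).2.im = 1 / (c : ℝ) ^ 2 := rfl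
  have h3 : 0 ≤ Real.log c := Real.log_natCast_nonneg c
  rw [h1, h2, Real.log_one, one_div, Real.log_inv, Real.log_pow, Real.dist_eq]
  push_cast
  rw [zero_sub, neg_neg, abs_of_nonneg (by positivity)]

theorem log_im_le {a : ℤ} {c : ℕ} (hc : 0 < c) {z : ℍ} (hz : z ∈ horoballAt a c) :
    Real.log z.im ≤ -(2 * Real.log c) := by
  have hz' : (c * z.re - a) ^ 2 + (c * z.im) ^ 2 ≤ z.im := by simpa [horoballAt] using hz
  have hy := z.im_pos
  have hc' : (0 : ℝ) < c := by exact_mod_cast hc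
  have h1 : z.im ≤ ((c : ℝ) ^ 2)⁻¹ := by
    rw [← one_div, le_div_iff₀ (by positivity)]
    have : (c * z.im) ^ 2 ≤ z.im := by nlinarith [sq_nonneg (c * z.re - a : ℝ)]
    nlinarith
  have := Real.log_le_log hy h1
  rwa [Real.log_inv, Real.log_pow] at this

theorem two_log_le_dist {a : ℤ} {c : ℕ} (hc : 0 < c) {z w : ℍ} (hz : z ∈ horoball)
    (hw : w ∈ horoballAt a c) : 2 * Real.log c ≤ dist z w := by
  have h1 := log_im_le hc hw
  have h2 : 0 ≤ Real.log z.im := Real.log_nonneg hz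
  refine le_trans ?_ (UpperHalfPlane.dist_log_im_le z w)
  rw [Real.dist_eq]
  exact le_trans (by linarith) (le_abs_self _)

theorem footArc_fst_mem (a : ℤ) {c : ℕ} (hc : 0 < c) : (footArc a c hc).1 ∈ horoball :=
  le_refl (1 : ℝ)

theorem footArc_snd_mem (a : ℤ) {c : ℕ} (hc : 0 < c) : (footArc a c hc).2 ∈ horoballAt a c := by
  have h1 : (footArc a c hc).2.re = a / c := rfl
  have h2 : (footArc a c hc).2.im = 1 / (c : ℝ) ^ 2 := rfl
  have hc' : (c : ℝ) ≠ 0 := by positivity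
  simp only [horoballAt, Set.mem_ofPred_eq, h1, h2, Int.cast_natCast]
  apply le_of_eq
  field_simp
  ring

theorem isShortestArc_footArc (a : ℤ) {c : ℕ} (hc : 0 < c) :
    IsShortestArc horoball (horoballAt a c) (footArc a c hc) :=
  ⟨footArc_fst_mem a hc, footArc_snd_mem a hc, fun _ hx _ hy => by
    rw [dist_footArc]; exact two_log_le_dist hc hx hy⟩

theorem eq_footArc_of_isShortestArc {a : ℤ} {c : ℕ} (hc : 0 < c) {p : ℍ × ℍ}
    (h : IsShortestArc horoball (horoballAt a c) p) : p = footArc a c hc := by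
  obtain ⟨h1, h2, h3⟩ := h
  have hle := h3 _ (footArc_fst_mem a hc) _ (footArc_snd_mem a hc)
  rw [dist_footArc] at hle
  have hd : dist p.1 p.2 = 2 * Real.log c := le_antisymm hle (two_log_le_dist hc h1 h2)
  have hlog := UpperHalfPlane.dist_log_im_le p.1 p.2
  have h4 := log_im_le hc h2
  have h5 : 0 ≤ Real.log p.1.im := Real.log_nonneg h1
  rw [Real.dist_eq, hd] at hlog
  have h6 := (le_abs_self _).trans hlog
  have hc' : (0 : ℝ) < c := by exact_mod_cast hc
  have e1 : p.1.im = 1 := Real.eq_one_of_pos_of_log_eq_zero p.1.im_pos (by linarith)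
  have e2 : p.2.im = 1 / (c : ℝ) ^ 2 := by
    refine Real.log_injOn_pos p.2.im_pos (show (0 : ℝ) < 1 / (c : ℝ) ^ 2 by positivity) ?_
    rw [one_div, Real.log_inv, Real.log_pow]
    push_cast
    linarith
  have e3 : p.2.re = a / c := by
    have h2' : (c * p.2.re - a) ^ 2 + (c * p.2.im) ^ 2 ≤ p.2.im := by simpa [horoballAt] using h2
    rw [e2] at h2'
    have : (c * (1 / (c : ℝ) ^ 2)) ^ 2 = 1 / (c : ℝ) ^ 2 := by field_simp
    rw [this] at h2'
    have h7 : (c * p.2.re - a : ℝ) ^ 2 = 0 := le_antisymm (by linarith) (sq_nonneg _)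
    have h8 := pow_eq_zero_iff two_ne_zero |>.mp h7
    rw [eq_div_iff hc'.ne']
    linarith
  -- The length of the arc equals the difference of the heights, hence the arc is vertical.
  have e4 : p.1.re = p.2.re := by
    have h7 := UpperHalfPlane.cosh_dist' p.1 p.2
    rw [hd, e1, e2,
      show 2 * Real.log c = Real.log ((c : ℝ) ^ 2) by rw [Real.log_pow]; push_cast; rfl,
      Real.cosh_log (by positivity)] at h7
    have h8 : (p.1.re - p.2.re) ^ 2 = 0 := by
      field_simp at h7
      have h9 : (c : ℝ) ^ 4 * (p.1.re - p.2.re) ^ 2 = 0 := by linarith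
      exact (mul_eq_zero.mp h9).resolve_left (by positivity)
    have := pow_eq_zero_iff two_ne_zero |>.mp h8
    linarith
  refine Prod.ext (UpperHalfPlane.ext ?_) (UpperHalfPlane.ext ?_)
  · exact Complex.ext (e4.trans e3) e1
  · exact Complex.ext e3 e2

theorem isShortestArc_self_dist {p : ℍ × ℍ} (h : IsShortestArc horoball horoball p) :
    dist p.1 p.2 = 0 :=
  le_antisymm (by simpa using h.2.2 _ h.1 _ h.1) dist_nonneg

/-- A shortest arc of positive length from the horoball at infinity to one of its translates. -/
theorem exists_eq_footArc {b : ℕ} {γ : heckeGroup b} {p : ℍ × ℍ}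
    (h : IsShortestArc horoball (γ • horoball) p) (hp : 0 < dist p.1 p.2) :
    ∃ (a : ℤ) (c : ℕ) (hc : 0 < c), 2 ≤ c ∧ b ∣ c ∧ IsCoprime a (c : ℤ) ∧
      γ • horoball = horoballAt a c ∧ p = footArc a c hc := by
  rcases smul_horoball_cases γ with hγ | ⟨a, c, hc, hbc, hac, hγ⟩
  · rw [hγ] at h
    exact absurd (isShortestArc_self_dist h) hp.ne'
  · rw [hγ] at h
    have he := eq_footArc_of_isShortestArc hc h
    refine ⟨a, c, hc, ?_, hbc, hac, hγ, he⟩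
    by_contra hlt
    have hc1 : c = 1 := by omega
    rw [he, dist_footArc, hc1] at hp
    simp at hp

/-! ### Orbits and multiplicities of the common perpendiculars -/

theorem two_log_pos {c : ℕ} (hc : 2 ≤ c) : 0 < 2 * Real.log c := by
  have : (1 : ℝ) < c := by exact_mod_cast hc
  have := Real.log_pos this
  positivity

theorem natCast_inj_of_two_log {c c' : ℕ} (hc : 0 < c) (hc' : 0 < c')
    (h : 2 * Real.log c = 2 * Real.log c') : c = c' := by
  have h1 : Real.log c = Real.log c' := by linarith
  exact_mod_cast Real.log_injOn_pos (show (0 : ℝ) < c by exact_mod_cast hc)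
    (show (0 : ℝ) < c' by exact_mod_cast hc') h1

/-- A matrix that maps a common perpendicular to a common perpendicular of the same length preserves
the heights of its two endpoints, which forces it to be upper triangular. -/
theorem lower_left_eq_zero {g : SL(2, ℤ)} {a a' : ℤ} {c : ℕ} (hc : 0 < c) (hc2 : 2 ≤ c)
    (h1 : g • (footArc a c hc).1 = (footArc a' c hc).1)
    (h2 : g • (footArc a c hc).2 = (footArc a' c hc).2) : g 1 0 = 0 := by
  have hd1 := denom_sq_pos g (footArc a c hc).1
  have hd2 := denom_sq_pos g (footArc a c hc).2
  have i1 := im_smul_eq g (footArc a c hc).1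
  have i2 := im_smul_eq g (footArc a c hc).2
  rw [h1, eq_div_iff hd1.ne'] at i1
  rw [h2, eq_div_iff hd2.ne'] at i2
  simp only [footArc, UpperHalfPlane.re, UpperHalfPlane.im] at i1 i2
  have hc' : (2 : ℝ) ≤ c := by exact_mod_cast hc2
  have i3 := mul_left_cancel₀ (show (1 : ℝ) / (c : ℝ) ^ 2 ≠ 0 by positivity)
    (i2.trans (mul_one _).symm)
  have h4 : (g 1 0 : ℝ) ^ 2 * (1 - (1 / (c : ℝ) ^ 2) ^ 2) = 0 := by nlinarith
  have h5 : 1 / (c : ℝ) ^ 2 ≤ 1 / 4 := by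
    apply one_div_le_one_div_of_le (by norm_num); nlinarith
  have h6 : (1 / (c : ℝ) ^ 2) ^ 2 ≤ (1 / 4) ^ 2 := by gcongr
  rcases mul_eq_zero.mp h4 with h | h
  · exact_mod_cast pow_eq_zero_iff two_ne_zero |>.mp h
  · norm_num at h6 h; linarith

theorem diag_of_lower_left_eq_zero {g : SL(2, ℤ)} (h : g 1 0 = 0) :
    (g 0 0 = 1 ∧ g 1 1 = 1) ∨ (g 0 0 = -1 ∧ g 1 1 = -1) := by
  have := g.det_coe
  rw [Matrix.det_fin_two, h, mul_zero, sub_zero] at this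
  exact Int.mul_eq_one_iff_eq_one_or_neg_one.mp this

theorem re_smul_eq {g : SL(2, ℤ)} (h : g 1 0 = 0) (z : ℍ) :
    (g • z).re = z.re + (g 0 1 * g 1 1 : ℤ) := by
  have h1 := congrArg Complex.re (UpperHalfPlane.coe_specialLinearGroup_apply g z)
  rw [UpperHalfPlane.coe_re] at h1
  rw [h1]
  rcases diag_of_lower_left_eq_zero h with ⟨ha, hd⟩ | ⟨ha, hd⟩
  · simp [h, ha, hd]
  · rw [h, ha, hd]
    simp [div_neg]
    ring

theorem footArc_congr {b : ℕ} {γ : heckeGroup b} {a a' : ℤ} {c : ℕ} {hc : 0 < c} (hc2 : 2 ≤ c)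
    (h : γ • footArc a c hc = footArc a' c hc) : (c : ℤ) ∣ a' - a ∧ γ • horoball = horoball ∧
      (a' = a → γ = 1) := by
  obtain ⟨g, hb, hg⟩ := exists_matrix γ
  have h1 : g • (footArc a c hc).1 = (footArc a' c hc).1 := by
    rw [← smul_eq_of_coe_eq hg]; exact congrArg Prod.fst h
  have h2 : g • (footArc a c hc).2 = (footArc a' c hc).2 := by
    rw [← smul_eq_of_coe_eq hg]; exact congrArg Prod.snd h
  have h0 := lower_left_eq_zero hc hc2 h1 h2
  have hc' : (c : ℝ) ≠ 0 := by positivity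
  have hre := re_smul_eq h0 (footArc a c hc).1
  rw [h1] at hre
  have e : a' - a = c * (g 0 1 * g 1 1) := by
    simp only [footArc, UpperHalfPlane.re] at hre
    field_simp at hre
    have : (a' : ℝ) = a + c * (g 0 1 * g 1 1 : ℤ) := hre
    have : a' = a + c * (g 0 1 * g 1 1) := by exact_mod_cast this
    linarith
  refine ⟨⟨_, e⟩, ?_, fun ha => ?_⟩
  · rw [smul_horoball_eq hg, h0]
    refine horoballAt_zero ?_
    rcases diag_of_lower_left_eq_zero h0 with ⟨h3, -⟩ | ⟨h3, -⟩ <;> rw [h3] <;> decide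
  · rw [ha, sub_self] at e
    have hc0 : (c : ℤ) ≠ 0 := by exact_mod_cast hc.ne'
    have h3 : g 0 1 = 0 := by
      rcases mul_eq_zero.mp ((mul_eq_zero.mp e.symm).resolve_left hc0) with h3 | h3
      · exact h3
      · rcases diag_of_lower_left_eq_zero h0 with ⟨-, h4⟩ | ⟨-, h4⟩ <;> omega
    have hcen : g ∈ Subgroup.center SL(2, ℤ) := by
      rw [Matrix.SpecialLinearGroup.mem_center_iff]
      rcases diag_of_lower_left_eq_zero h0 with ⟨h4, h5⟩ | ⟨h4, h5⟩
      · refine ⟨1, by simp, ?_⟩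
        ext i j
        fin_cases i <;> fin_cases j <;> simp [h0, h3, h4, h5]
      · refine ⟨-1, by simp, ?_⟩
        ext i j
        fin_cases i <;> fin_cases j <;> simp [h0, h3, h4, h5]
    apply Subtype.ext
    rw [hg]
    exact (QuotientGroup.eq_one_iff g).mpr hcen

theorem exists_smul_footArc (b : ℕ) (a n : ℤ) {c : ℕ} (hc : 0 < c) :
    ∃ γ : heckeGroup b, γ • footArc a c hc = footArc (a + n * c) c hc := by
  let g : SL(2, ℤ) := ⟨!![1, n; 0, 1], by rw [Matrix.det_fin_two_of]; ring⟩
  have h0 : g 1 0 = 0 := rfl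
  have hc' : (c : ℝ) ≠ 0 := by positivity
  refine ⟨heckeMk g (by rw [h0]; exact dvd_zero _), ?_⟩
  have hre : ∀ z : ℍ, (g • z).re = z.re + n := fun z => by
    rw [re_smul_eq h0]; simp [g]
  have him : ∀ z : ℍ, (g • z).im = z.im := fun z => by
    rw [im_smul_eq]; simp [g]
  refine Prod.ext (UpperHalfPlane.ext (Complex.ext ?_ ?_))
    (UpperHalfPlane.ext (Complex.ext ?_ ?_))
  · change (heckeMk g _ • (footArc a c hc).1).re = ((a + n * c : ℤ) : ℝ) / c
    rw [heckeMk_smul, hre]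
    change (a : ℝ) / c + n = _
    push_cast
    field_simp
  · change (heckeMk g _ • (footArc a c hc).1).im = 1
    rw [heckeMk_smul, him]
    rfl
  · change (heckeMk g _ • (footArc a c hc).2).re = ((a + n * c : ℤ) : ℝ) / c
    rw [heckeMk_smul, hre]
    change (a : ℝ) / c + n = _
    push_cast
    field_simp
  · change (heckeMk g _ • (footArc a c hc).2).im = 1 / (c : ℝ) ^ 2
    rw [heckeMk_smul, him]
    rfl

theorem footArc_injective {a a' : ℤ} {c c' : ℕ} {hc : 0 < c} {hc' : 0 < c'}
    (h : footArc a c hc = footArc a' c' hc') : a = a' ∧ c = c' := by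
  have h1 := dist_footArc a hc
  rw [h, dist_footArc] at h1
  obtain rfl := natCast_inj_of_two_log hc' hc h1
  refine ⟨?_, rfl⟩
  have h2 : (footArc a c' hc).1.re = (footArc a' c' hc').1.re := by rw [h]
  simp only [footArc, UpperHalfPlane.re] at h2
  have hc0 : (c' : ℝ) ≠ 0 := by positivity
  field_simp at h2
  exact_mod_cast h2

theorem translatePairs_footArc {b : ℕ} {a : ℤ} {c : ℕ} (hc : 0 < c) (hc2 : 2 ≤ c) (hbc : b ∣ c)
    (hac : IsCoprime a (c : ℤ)) :
    translatePairs (heckeGroup b) horoball horoball (footArc a c hc) =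
      {(horoball, horoballAt a c)} := by
  ext ⟨A, B⟩
  simp only [translatePairs, Set.mem_ofPred_eq, Set.mem_singleton_iff, Prod.mk.injEq]
  constructor
  · rintro ⟨⟨γ, rfl⟩, ⟨γ', rfl⟩, h⟩
    have hpos : 0 < dist (footArc a c hc).1 (footArc a c hc).2 := by
      rw [dist_footArc]; exact two_log_pos hc2
    have h1 := isShortestArc_smul (heckeGroup b) γ⁻¹ h
    simp only [← mul_smul, inv_mul_cancel, one_smul] at h1
    obtain ⟨a', c', hc', -, -, -, -, he⟩ := exists_eq_footArc h1 (by simpa using hpos)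
    have hcc : c = c' := by
      refine natCast_inj_of_two_log hc hc' ?_
      rw [← dist_footArc a hc, ← dist_footArc a' hc', ← he]
      simp
    subst hcc
    have h2 := (footArc_congr hc2 he).2.1
    have h3 : γ • horoball = horoball := by
      nth_rewrite 1 [← h2]
      rw [smul_inv_smul]
    refine ⟨h3, ?_⟩
    simp only [h3] at h
    obtain ⟨a'', c'', hc'', -, -, -, h4, h5⟩ := exists_eq_footArc h hpos
    obtain ⟨rfl, rfl⟩ := footArc_injective h5
    exact h4
  · rintro ⟨rfl, rfl⟩
    refine ⟨MulAction.mem_orbit_self _, ?_, isShortestArc_footArc a hc⟩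
    obtain ⟨γ, hγ⟩ := exists_smul_horoball (b := b) (by exact_mod_cast hbc) hac
    exact ⟨γ, hγ⟩

theorem arcFixator_footArc (b : ℕ) (a : ℤ) {c : ℕ} (hc : 0 < c) (hc2 : 2 ≤ c) :
    arcFixator (heckeGroup b) (footArc a c hc) = {1} := by
  ext γ
  simp only [arcFixator, Set.mem_ofPred_eq, Set.mem_singleton_iff]
  constructor
  · intro h
    refine (footArc_congr (a := a) (a' := a) (hc := hc) hc2 (Prod.ext ?_ ?_)).2.2 rfl
    · exact h _ (by simp [arcTrace])
    · exact h _ (by simp [arcTrace])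
  · rintro rfl z _
    exact one_smul _ z

theorem arcMult_footArc {b : ℕ} {a : ℤ} {c : ℕ} (hc : 0 < c) (hc2 : 2 ≤ c) (hbc : b ∣ c)
    (hac : IsCoprime a (c : ℤ)) :
    arcMult (heckeGroup b) horoball horoball (footArc a c hc) = 1 := by
  rw [arcMult, translatePairs_footArc hc hc2 hbc hac, arcFixator_footArc b a hc hc2]
  simp

/-- The common perpendicular over `a / c`. -/
def footOrbit (b : ℕ) (a : ℤ) (c : ℕ) (hc : 0 < c) :
    MulAction.orbitRel.Quotient (heckeGroup b) (ℍ × ℍ) :=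
  Quotient.mk _ (footArc a c hc)

theorem footOrbit_eq_iff {b : ℕ} {a a' : ℤ} {c : ℕ} (hc : 0 < c) (hc2 : 2 ≤ c) :
    footOrbit b a c hc = footOrbit b a' c hc ↔ (c : ℤ) ∣ a' - a := by
  rw [footOrbit, footOrbit, eq_comm, Quotient.eq, MulAction.orbitRel_apply]
  constructor
  · rintro ⟨γ, hγ⟩
    exact (footArc_congr hc2 hγ).1
  · rintro ⟨n, hn⟩
    obtain ⟨γ, hγ⟩ := exists_smul_footArc b a n hc
    refine ⟨γ, hγ.trans ?_⟩
    rw [show a + n * c = a' by linarith]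

theorem mem_commonPerp_iff {b : ℕ} (α : MulAction.orbitRel.Quotient (heckeGroup b) (ℍ × ℍ)) :
    α ∈ commonPerp (heckeGroup b) horoball horoball ↔ ∃ (a : ℤ) (c : ℕ) (hc : 0 < c), 2 ≤ c ∧
      b ∣ c ∧ IsCoprime a (c : ℤ) ∧ α = footOrbit b a c hc := by
  constructor
  · rintro ⟨γ, p, hp, hd, rfl⟩
    obtain ⟨a, c, hc, hc2, hbc, hac, -, rfl⟩ := exists_eq_footArc hp hd
    exact ⟨a, c, hc, hc2, hbc, hac, rfl⟩
  · rintro ⟨a, c, hc, hc2, hbc, hac, rfl⟩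
    obtain ⟨γ, hγ⟩ := exists_smul_horoball (b := b) (by exact_mod_cast hbc) hac
    refine ⟨γ, footArc a c hc, hγ ▸ isShortestArc_footArc a hc, ?_, rfl⟩
    rw [dist_footArc]
    exact two_log_pos hc2

theorem orbitLength_footOrbit (b : ℕ) (a : ℤ) {c : ℕ} (hc : 0 < c) :
    orbitLength (heckeGroup b) (footOrbit b a c hc) = 2 * Real.log c :=
  dist_footArc a hc

/-- The lengths of the common perpendiculars are the numbers `2 log c` with `b ∣ c`, `c ≥ 2`. -/
theorem mem_orthoLengths_iff {b : ℕ} (ℓ : ℝ) :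
    ℓ ∈ orthoLengths (heckeGroup b) horoball horoball ↔
      ∃ c : ℕ, 2 ≤ c ∧ b ∣ c ∧ ℓ = 2 * Real.log c := by
  constructor
  · rintro ⟨α, hα, rfl⟩
    obtain ⟨a, c, hc, hc2, hbc, -, rfl⟩ := (mem_commonPerp_iff α).mp hα
    exact ⟨c, hc2, hbc, orbitLength_footOrbit b a hc⟩
  · rintro ⟨c, hc2, hbc, rfl⟩
    have hc : 0 < c := by omega
    exact ⟨footOrbit b 1 c hc, (mem_commonPerp_iff _).mpr
      ⟨1, c, hc, hc2, hbc, isCoprime_one_left, rfl⟩, orbitLength_footOrbit b 1 hc⟩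

/-- The length multiplicity of `2 log c` is `φ(c)`. -/
theorem lengthMult_two_log {b c : ℕ} (hc2 : 2 ≤ c) (hbc : b ∣ c) :
    lengthMult (heckeGroup b) horoball horoball (2 * Real.log c) = c.totient := by
  have hc : 0 < c := by omega
  set S := {α : MulAction.orbitRel.Quotient (heckeGroup b) (ℍ × ℍ) |
    α ∈ commonPerp (heckeGroup b) horoball horoball ∧
      orbitLength (heckeGroup b) α = 2 * Real.log c} with hS
  -- The fractions `a / c` modulo integral translations are the invertible classes modulo `c`.
  set R := (Finset.range c).filter (c.Coprime ·) with hR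
  have hSR : S = (fun a : ℕ => footOrbit b a c hc) '' R := by
    ext α
    simp only [hS, hR, Set.mem_ofPred_eq, Set.mem_image, Finset.coe_filter, Finset.mem_range]
    constructor
    · rintro ⟨hα, hl⟩
      obtain ⟨a, c', hc', -, -, hac, rfl⟩ := (mem_commonPerp_iff α).mp hα
      rw [orbitLength_footOrbit] at hl
      obtain rfl := natCast_inj_of_two_log hc' hc hl
      have hc0 : (c' : ℤ) ≠ 0 := by exact_mod_cast hc.ne'
      have hnn := Int.emod_nonneg a hc0
      have hcast : (((a % c').toNat : ℕ) : ℤ) = a % c' := Int.toNat_of_nonneg hnn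
      refine ⟨(a % c').toNat, ⟨?_, ?_⟩, ?_⟩
      · have := Int.emod_lt_of_pos a (show (0 : ℤ) < c' by exact_mod_cast hc)
        omega
      · rw [← Nat.isCoprime_iff_coprime, hcast]
        have : a % c' = a + c' * (-(a / c')) := by have := Int.emod_def a c'; linarith
        rw [this]
        exact (IsCoprime.add_mul_left_left hac _).symm
      · rw [footOrbit_eq_iff hc hc2, hcast]
        exact Int.dvd_self_sub_emod
    · rintro ⟨a, ⟨-, ha⟩, rfl⟩
      exact ⟨(mem_commonPerp_iff _).mpr ⟨a, c, hc, hc2, hbc,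
        (Nat.isCoprime_iff_coprime.mpr ha).symm, rfl⟩, orbitLength_footOrbit b a hc⟩
  have hinj : Set.InjOn (fun a : ℕ => footOrbit b a c hc) R := by
    intro a ha a' ha' h
    simp only [hR, Finset.coe_filter, Finset.mem_range, Set.mem_ofPred_eq] at ha ha'
    have h1 := (footOrbit_eq_iff hc hc2).mp h
    have h2 := Int.eq_zero_of_abs_lt_dvd h1 (by rw [abs_lt]; omega)
    omega
  have hone : ∀ α : S, orbitMult (heckeGroup b) horoball horoball α.1 = 1 := by
    rintro ⟨α, hα⟩
    obtain ⟨a, c', hc', hc2', hbc', hac, rfl⟩ := (mem_commonPerp_iff α).mp hα.1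
    exact arcMult_footArc hc' hc2' hbc' hac
  change ∑' α : S, orbitMult (heckeGroup b) horoball horoball α.1 = _
  rw [tsum_congr hone, ENNReal.tsum_set_one, hSR, hinj.encard_image,
    Set.encard_coe_eq_coe_finsetCard]
  rfl

/-! ### The pair correlation measures as finite sums -/

/-- The multiples `c` of `b` with `2 ≤ c ≤ N`. -/
def levelSet (b N : ℕ) : Finset ℕ := (Finset.Ioc 0 N).filter fun c => 2 ≤ c ∧ b ∣ c

theorem mem_levelSet {b N c : ℕ} : c ∈ levelSet b N ↔ 2 ≤ c ∧ b ∣ c ∧ c ≤ N := by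
  simp only [levelSet, Finset.mem_filter, Finset.mem_Ioc]
  omega

theorem two_log_mem_Icc_iff {c N : ℕ} (hc : 2 ≤ c) :
    2 * Real.log c ∈ Set.Icc 0 (2 * Real.log N) ↔ c ≤ N := by
  have hpos := two_log_pos hc
  rw [Set.mem_Icc, and_iff_right hpos.le]
  rcases N.eq_zero_or_pos with rfl | hN
  · simp only [Nat.cast_zero, Real.log_zero, mul_zero]
    constructor
    · intro h; linarith
    · intro h; omega
  · rw [mul_le_mul_iff_of_pos_left two_pos, Real.log_le_log_iff
      (by exact_mod_cast (by omega : 0 < c)) (by exact_mod_cast hN), Nat.cast_le]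

theorem cuspPairCorrelation_eq_sum (b : ℕ) (ψ : ℕ → ℝ) (N : ℕ) :
    cuspPairCorrelation b ψ N = ∑ p ∈ (levelSet b N).offDiag,
      ((p.1.totient : ℝ≥0∞) * p.2.totient) •
        Measure.dirac (ψ N * (2 * Real.log p.2 - 2 * Real.log p.1)) := by
  set F : Set ℝ := orthoLengths (heckeGroup b) horoball horoball ∩
    Set.Icc 0 (2 * Real.log N) with hF
  have hmem : ∀ c ∈ levelSet b N, 2 * Real.log c ∈ F := fun c hc => by
    obtain ⟨h1, h2, h3⟩ := mem_levelSet.mp hc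
    exact ⟨(mem_orthoLengths_iff _).mpr ⟨c, h1, h2, rfl⟩, (two_log_mem_Icc_iff h1).mpr h3⟩
  have hmem' : ∀ ℓ ∈ F, ∃ c ∈ levelSet b N, ℓ = 2 * Real.log c := by
    rintro ℓ ⟨h1, h2⟩
    obtain ⟨c, hc, hbc, rfl⟩ := (mem_orthoLengths_iff _).mp h1
    exact ⟨c, mem_levelSet.mpr ⟨hc, hbc, (two_log_mem_Icc_iff hc).mp h2⟩, rfl⟩
  have hinj : ∀ c ∈ levelSet b N, ∀ c' ∈ levelSet b N, 2 * Real.log c = 2 * Real.log c' →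
      c = c' := fun c hc c' hc' h => natCast_inj_of_two_log
        (by have := (mem_levelSet.mp hc).1; omega) (by have := (mem_levelSet.mp hc').1; omega) h
  let e : {x // x ∈ (levelSet b N).offDiag} → {p : ℝ × ℝ // p.1 ∈ F ∧ p.2 ∈ F ∧ p.1 ≠ p.2} :=
    fun x => ⟨(2 * Real.log x.1.1, 2 * Real.log x.1.2), by
      obtain ⟨h1, h2, h3⟩ := Finset.mem_offDiag.mp x.2
      exact ⟨hmem _ h1, hmem _ h2, fun h => h3 (hinj _ h1 _ h2 h)⟩⟩
  have he : Function.Bijective e := by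
    constructor
    · rintro ⟨x, hx⟩ ⟨y, hy⟩ h
      obtain ⟨h1, h2, -⟩ := Finset.mem_offDiag.mp hx
      obtain ⟨h3, h4, -⟩ := Finset.mem_offDiag.mp hy
      have h5 := congrArg Subtype.val h
      exact Subtype.ext (Prod.ext (hinj _ h1 _ h3 (congrArg Prod.fst h5))
        (hinj _ h2 _ h4 (congrArg Prod.snd h5)))
    · rintro ⟨⟨x, y⟩, hx, hy, hxy⟩
      obtain ⟨c, hc, rfl⟩ := hmem' x hx
      obtain ⟨c', hc', rfl⟩ := hmem' y hy
      exact ⟨⟨(c, c'), Finset.mem_offDiag.mpr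
        ⟨hc, hc', fun h => hxy (by simp only at h ⊢; rw [h])⟩⟩, rfl⟩
  ext s hs
  change (Measure.sum fun p : {p : ℝ × ℝ // p.1 ∈ F ∧ p.2 ∈ F ∧ p.1 ≠ p.2} =>
    (lengthMult (heckeGroup b) horoball horoball p.1.1 *
      lengthMult (heckeGroup b) horoball horoball p.1.2) •
      Measure.dirac (ψ N * (p.1.2 - p.1.1))) s = _
  rw [Measure.sum_apply _ hs, ← (Equiv.ofBijective e he).tsum_eq, Measure.finsetSum_apply,
    tsum_fintype, ← Finset.sum_coe_sort (levelSet b N).offDiag]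
  apply Fintype.sum_congr
  intro x
  obtain ⟨h1, h2, -⟩ := Finset.mem_offDiag.mp x.2
  obtain ⟨h3, h4, -⟩ := mem_levelSet.mp h1
  obtain ⟨h5, h6, -⟩ := mem_levelSet.mp h2
  simp only [Equiv.ofBijective_apply, e]
  rw [lengthMult_two_log h3 h4, lengthMult_two_log h5 h6]

instance isFiniteMeasure_cuspPairCorrelation (b : ℕ) (ψ : ℕ → ℝ) (N : ℕ) :
    IsFiniteMeasure (cuspPairCorrelation b ψ N) := by
  rw [cuspPairCorrelation_eq_sum]
  refine ⟨?_⟩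
  rw [Measure.finsetSum_apply]
  refine ENNReal.sum_lt_top.mpr fun p _ => ?_
  rw [Measure.smul_apply, measure_univ, smul_eq_mul, mul_one]
  exact ENNReal.mul_lt_top (ENNReal.natCast_lt_top _) (ENNReal.natCast_lt_top _)

theorem integral_cuspPairCorrelation (b : ℕ) (ψ : ℕ → ℝ) (N : ℕ) (f : ℝ → ℂ) :
    ∫ s, f s ∂(cuspPairCorrelation b ψ N) =
      ∑ p ∈ (levelSet b N).offDiag, ((p.1.totient : ℂ) * p.2.totient) *
        f (ψ N * (2 * Real.log p.2 - 2 * Real.log p.1)) := by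
  rw [cuspPairCorrelation_eq_sum, integral_finsetSum_measure]
  · refine Finset.sum_congr rfl fun p _ => ?_
    rw [integral_smul_measure, integral_dirac, ENNReal.toReal_mul]
    simp
  · intro p _
    exact ((integrable_dirac (by simp))).smul_measure
      (ENNReal.mul_ne_top (ENNReal.natCast_ne_top _) (ENNReal.natCast_ne_top _))

/-! ### The two-sided exponential law -/

/-- The density of the opposite of a standard exponential random variable. -/
def negExpDensity (u : ℝ) : ℝ≥0∞ := (Set.Iic 0).indicator (fun u => ENNReal.ofReal (Real.exp u)) u

/-- The law of the opposite of a standard exponential random variable. -/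
def negExpMeasure : Measure ℝ := volume.withDensity negExpDensity

/-- The two-sided exponential law. -/
def laplaceMeasure : Measure ℝ :=
  volume.withDensity fun s : ℝ => ENNReal.ofReal (1 / 2 * Real.exp (-|s|))

theorem measurable_negExpDensity : Measurable negExpDensity :=
  (Real.measurable_exp.ennreal_ofReal).indicator measurableSet_Iic

instance isProbabilityMeasure_negExpMeasure : IsProbabilityMeasure negExpMeasure := by
  refine ⟨?_⟩
  rw [negExpMeasure, withDensity_apply _ MeasurableSet.univ, Measure.restrict_univ]
  unfold negExpDensity
  rw [lintegral_indicator measurableSet_Iic, ← ofReal_integral_eq_lintegral_ofReal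
    (integrableOn_exp_Iic 0) (ae_of_all _ fun _ => (Real.exp_pos _).le), integral_exp_Iic_zero,
    ENNReal.ofReal_one]

theorem lintegral_negExpDensity_mul (s : ℝ) :
    ∫⁻ v, negExpDensity v * negExpDensity (v - s) = ENNReal.ofReal (1 / 2 * Real.exp (-|s|)) := by
  have h : ∀ v, negExpDensity v * negExpDensity (v - s) = (Set.Iic (min 0 s)).indicator
      (fun v => ENNReal.ofReal (Real.exp (-s) * Real.exp (2 * v))) v := by
    intro v
    simp only [negExpDensity, Set.indicator_apply, Set.mem_Iic, le_min_iff, sub_nonpos]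
    by_cases h1 : v ≤ 0 <;> by_cases h2 : v ≤ s <;> simp only [h1, h2, if_true, if_false,
      and_self, and_true, and_false, mul_zero, zero_mul]
    rw [← ENNReal.ofReal_mul (Real.exp_pos _).le, ← Real.exp_add, ← Real.exp_add]
    ring_nf
  simp only [h]
  rw [lintegral_indicator measurableSet_Iic, ← ofReal_integral_eq_lintegral_ofReal
    ((integrableOn_exp_mul_Iic two_pos _).const_mul _) (ae_of_all _ fun _ => by positivity),
    integral_const_mul, integral_exp_mul_Iic two_pos, ← mul_div_assoc, ← Real.exp_add]
  congr 1
  rw [one_div, inv_mul_eq_div]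
  congr 2
  rcases le_total 0 s with hs | hs
  · rw [min_eq_left hs, abs_of_nonneg hs]; ring
  · rw [min_eq_right hs, abs_of_nonpos hs]; ring

/-- The difference of two independent exponential variables follows the two-sided exponential
law. -/
theorem map_sub_negExpMeasure :
    (negExpMeasure.prod negExpMeasure).map (fun p : ℝ × ℝ => p.2 - p.1) = laplaceMeasure := by
  refine Measure.ext_of_lintegral _ fun F hF => ?_
  have hm := measurable_negExpDensity
  rw [lintegral_map hF (by fun_prop), lintegral_prod_symm' _ (by fun_prop), negExpMeasure,
    laplaceMeasure, lintegral_withDensity_eq_lintegral_mul _ hm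
      (Measurable.lintegral_prod_left' (f := fun p : ℝ × ℝ => F (p.2 - p.1)) (by fun_prop)),
    lintegral_withDensity_eq_lintegral_mul _ (by fun_prop) hF]
  have h1 : ∀ v, ∫⁻ u, F (v - u) ∂(volume.withDensity negExpDensity) =
      ∫⁻ s, negExpDensity (v - s) * F s := by
    intro v
    rw [lintegral_withDensity_eq_lintegral_mul _ hm (by fun_prop),
      ← lintegral_sub_left_eq_self _ v]
    simp
  simp only [Pi.mul_apply, h1]
  calc _ = ∫⁻ v, ∫⁻ s, negExpDensity v * (negExpDensity (v - s) * F s) := by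
        refine lintegral_congr fun v => ?_
        rw [lintegral_const_mul]
        fun_prop
    _ = ∫⁻ s, ∫⁻ v, negExpDensity v * (negExpDensity (v - s) * F s) := by
        rw [lintegral_lintegral_swap]
        exact Measurable.aemeasurable (by fun_prop)
    _ = _ := by
        refine lintegral_congr fun s => ?_
        rw [← lintegral_negExpDensity_mul s, ← lintegral_mul_const _ (by fun_prop)]
        simp only [mul_assoc]

theorem integral_negExpMeasure (f : ℝ → ℂ) :
    ∫ u, f u ∂negExpMeasure = ∫ u in Set.Iic 0, (Real.exp u : ℂ) * f u := by
  rw [negExpMeasure, integral_withDensity_eq_integral_toReal_smul measurable_negExpDensity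
    (ae_of_all _ fun u => by
      unfold negExpDensity
      exact (Set.indicator_le_self _ _ u).trans_lt ENNReal.ofReal_lt_top),
    ← integral_indicator measurableSet_Iic]
  refine integral_congr_ae (ae_of_all _ fun u => ?_)
  simp only [negExpDensity, Set.indicator_apply]
  split_ifs
  · rw [ENNReal.toReal_ofReal (Real.exp_pos _).le, Complex.real_smul]
  · simp

/-- The variable `2 log t`, for `t` of density `2 t` on `[0, 1]`, is the opposite of a standard
exponential variable. -/
theorem integral_mul_comp_two_log (f : ℝ → ℂ) :
    ∫ t in (0 : ℝ)..1, (t : ℂ) * f (2 * Real.log t) = 1 / 2 * ∫ u, f u ∂negExpMeasure := by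
  have himage : (fun u : ℝ => Real.exp (u / 2)) '' Set.Iic 0 = Set.Ioc 0 1 := by
    ext t
    constructor
    · rintro ⟨u, hu, rfl⟩
      rw [Set.mem_Iic] at hu
      exact ⟨Real.exp_pos _, Real.exp_le_one_iff.mpr (by linarith)⟩
    · rintro ⟨h0, h1⟩
      refine ⟨2 * Real.log t, ?_, ?_⟩
      · rw [Set.mem_Iic]
        have := Real.log_nonpos h0.le h1
        linarith
      · beta_reduce
        rw [mul_div_cancel_left₀ _ two_ne_zero, Real.exp_log h0]
  have hderiv : ∀ u ∈ Set.Iic (0 : ℝ), HasDerivWithinAt (fun u => Real.exp (u / 2))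
      (Real.exp (u / 2) * (1 / 2)) (Set.Iic 0) u := fun u _ =>
    ((hasDerivAt_id u).div_const 2).exp.hasDerivWithinAt
  rw [intervalIntegral.integral_of_le zero_le_one, ← himage,
    integral_image_eq_integral_abs_deriv_smul measurableSet_Iic hderiv
      (fun u _ v _ h => by have := Real.exp_injective h; linarith),
    integral_negExpMeasure, ← integral_const_mul]
  refine integral_congr_ae (ae_of_all _ fun u => ?_)
  beta_reduce
  rw [abs_of_pos (by positivity), Real.log_exp, mul_div_cancel₀ _ two_ne_zero,
    Complex.real_smul, show Real.exp u = Real.exp (u / 2) * Real.exp (u / 2) by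
      rw [← Real.exp_add, add_halves]]
  push_cast
  ring

/-! ### The unscaled pair correlations -/

theorem HasMean.congr {h h' : ℕ → ℝ} {m : ℝ} (hm : HasMean h m) (k : ℕ)
    (heq : ∀ n, k < n → h n = h' n) : HasMean h' m := by
  have h0 : Tendsto (fun N : ℕ => (∑ n ∈ Finset.Ioc 0 k, (h' n - h n)) / (N : ℝ)) atTop (𝓝 0) :=
    tendsto_const_div_atTop_nhds_zero_nat _
  have h1 := hm.add h0
  rw [add_zero] at h1
  refine h1.congr' ?_
  filter_upwards [eventually_ge_atTop k] with N hN
  rw [← add_div]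
  congr 1
  have h2 : ∑ n ∈ Finset.Ioc 0 k, (h' n - h n) = ∑ n ∈ Finset.Ioc 0 N, (h' n - h n) := by
    refine Finset.sum_subset (Finset.Ioc_subset_Ioc_right hN) fun n hn hn' => ?_
    simp only [Finset.mem_Ioc] at hn hn'
    rw [heq n (by omega), sub_self]
  rw [h2, Finset.sum_sub_distrib]
  ring

/-- The ratio `φ(n) / n` restricted to the multiples of `b` that are at least `2`. -/
def levelWeight (b n : ℕ) : ℝ := if 2 ≤ n ∧ b ∣ n then totientRatio n else 0

theorem levelWeight_mem (b n : ℕ) : 0 ≤ levelWeight b n ∧ levelWeight b n ≤ 1 := by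
  unfold levelWeight
  split_ifs
  · exact totientRatio_mem n
  · norm_num

theorem exists_hasMean_levelWeight {b : ℕ} (hb : 0 < b) :
    ∃ m : ℝ, 0 < m ∧ HasMean (levelWeight b) m := by
  obtain ⟨m, hm, h⟩ := exists_hasMean_totientRatio hb
  refine ⟨m, hm, h.congr 1 fun n hn => ?_⟩
  simp [levelWeight, show 2 ≤ n from hn]

theorem sum_levelSet (b N : ℕ) (X : ℕ → ℂ) :
    ∑ c ∈ levelSet b N, (c.totient : ℂ) * X c =
      ∑ n ∈ Finset.Ioc 0 N, (levelWeight b n : ℂ) * (n * X n) := by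
  rw [levelSet, Finset.sum_filter]
  refine Finset.sum_congr rfl fun n hn => ?_
  have hn0 : (n : ℂ) ≠ 0 := by exact_mod_cast (Finset.mem_Ioc.mp hn).1.ne'
  unfold levelWeight
  split_ifs
  · simp only [totientRatio]
    push_cast
    field_simp
  · simp

/-- The sum of `φ(c)` over the multiples `c` of `b` with `2 ≤ c ≤ N`. -/
def totalMass (b N : ℕ) : ℝ := ∑ c ∈ levelSet b N, (c.totient : ℝ)

theorem totalMass_nonneg (b N : ℕ) : 0 ≤ totalMass b N :=
  Finset.sum_nonneg fun _ _ => Nat.cast_nonneg _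

/-- At `t = 0` the logarithm takes a junk value, which the factor `t` makes harmless. -/
theorem continuous_mul_comp_two_log {f : ℝ → ℂ} (hf : Continuous f) {C : ℝ}
    (hC : ∀ x, ‖f x‖ ≤ C) : Continuous fun t : ℝ => (t : ℂ) * f (2 * Real.log t) := by
  rw [continuous_iff_continuousAt]
  intro t
  rcases eq_or_ne t 0 with rfl | ht
  · have : Tendsto (fun t : ℝ => (t : ℂ) * f (2 * Real.log t)) (𝓝 0) (𝓝 0) := by
      refine squeeze_zero_norm (a := fun t : ℝ => |t| * C) (fun t => ?_) ?_
      · rw [norm_mul, Complex.norm_real, Real.norm_eq_abs]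
        gcongr
        exact hC _
      · have : Continuous fun t : ℝ => |t| * C := by fun_prop
        simpa using this.tendsto 0
    simpa [ContinuousAt] using this
  · have := Real.continuousAt_log ht
    have h2 : ContinuousAt (fun t => f (2 * Real.log t)) t :=
      hf.continuousAt.comp (this.const_mul 2)
    exact Complex.continuous_ofReal.continuousAt.mul h2

theorem tendsto_sum_totient_two_log {b : ℕ} {m : ℝ} (hm : HasMean (levelWeight b) m) {f : ℝ → ℂ}
    (hf : Continuous f) {C : ℝ} (hC : ∀ x, ‖f x‖ ≤ C) :
    Tendsto (fun N : ℕ => (∑ c ∈ levelSet b N, (c.totient : ℂ) * f (2 * Real.log (c / N))) /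
      (N : ℂ) ^ 2) atTop (𝓝 (m / 2 * ∫ u, f u ∂negExpMeasure)) := by
  have h := (riemannTendsto_of_continuousOn hm (fun n => (levelWeight_mem b n).1)
    (fun n => (levelWeight_mem b n).2)
    (continuous_mul_comp_two_log hf hC).continuousOn).tendsto
  rw [integral_mul_comp_two_log, ← mul_assoc, mul_one_div] at h
  refine h.congr' ?_
  filter_upwards [eventually_gt_atTop 0] with N hN
  have hN0 : (N : ℂ) ≠ 0 := by exact_mod_cast hN.ne'
  rw [sum_levelSet b N fun c => f (2 * Real.log (c / N)), Finset.sum_div, Finset.sum_div]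
  refine Finset.sum_congr rfl fun n _ => ?_
  push_cast
  field_simp

theorem tendsto_totalMass {b : ℕ} {m : ℝ} (hm : HasMean (levelWeight b) m) :
    Tendsto (fun N : ℕ => totalMass b N / (N : ℝ) ^ 2) atTop (𝓝 (m / 2)) := by
  have h := tendsto_sum_totient_two_log hm (f := fun _ => 1) continuous_const (C := 1) (by simp)
  simp only [integral_const, probReal_univ, one_smul, mul_one] at h
  have h2 := (Complex.continuous_re.tendsto _).comp h
  have e : ((m : ℂ) / 2).re = m / 2 := by
    rw [show (m : ℂ) / 2 = ((m / 2 : ℝ) : ℂ) by push_cast; rfl, Complex.ofReal_re]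
  rw [e] at h2
  refine h2.congr fun N => ?_
  rw [Function.comp_apply, show (∑ c ∈ levelSet b N, (c.totient : ℂ)) / (N : ℂ) ^ 2 =
    ((totalMass b N / (N : ℝ) ^ 2 : ℝ) : ℂ) by unfold totalMass; push_cast; rfl,
    Complex.ofReal_re]

theorem eventually_totalMass_pos {b : ℕ} (hb : 0 < b) : ∀ᶠ N in atTop, 0 < totalMass b N := by
  filter_upwards [eventually_ge_atTop (2 * b)] with N hN
  refine Finset.sum_pos' (fun _ _ => Nat.cast_nonneg _) ⟨2 * b, ?_, ?_⟩
  · exact mem_levelSet.mpr ⟨by omega, dvd_mul_left _ _, hN⟩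
  · exact_mod_cast Nat.totient_pos.mpr (by omega)

/-- The law of `2 log (c / N)`, for `c` chosen in the level set with probability proportional
to `φ(c)`. -/
theorem exists_levelLaw (b N : ℕ) : ∃ P : ProbabilityMeasure ℝ, 0 < totalMass b N →
    ∀ g : ℝ → ℂ, ∫ u, g u ∂(P : Measure ℝ) =
      (∑ c ∈ levelSet b N, (c.totient : ℂ) * g (2 * Real.log (c / N))) / totalMass b N := by
  by_cases h : 0 < totalMass b N
  · have hT : ENNReal.ofReal (totalMass b N) = ∑ c ∈ levelSet b N, (c.totient : ℝ≥0∞) := by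
      rw [totalMass, ENNReal.ofReal_sum_of_nonneg fun _ _ => Nat.cast_nonneg _]
      simp
    have hP : IsProbabilityMeasure ((ENNReal.ofReal (totalMass b N))⁻¹ •
        ∑ c ∈ levelSet b N, (c.totient : ℝ≥0∞) • Measure.dirac (2 * Real.log (c / N))) := by
      refine ⟨?_⟩
      rw [Measure.smul_apply, Measure.finsetSum_apply]
      simp only [Measure.smul_apply, measure_univ, smul_eq_mul, mul_one]
      rw [← hT]
      exact ENNReal.inv_mul_cancel (by simpa using h) ENNReal.ofReal_ne_top
    refine ⟨⟨_, hP⟩, fun _ g => ?_⟩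
    rw [ProbabilityMeasure.coe_mk, integral_smul_measure, integral_finsetSum_measure]
    · rw [ENNReal.toReal_inv, ENNReal.toReal_ofReal h.le, Complex.real_smul, div_eq_inv_mul]
      push_cast
      congr 1
      refine Finset.sum_congr rfl fun c _ => ?_
      rw [integral_smul_measure, integral_dirac]
      simp
    · intro c _
      exact (integrable_dirac (by simp)).smul_measure (ENNReal.natCast_ne_top _)
  · exact ⟨⟨Measure.dirac 0, inferInstance⟩, fun h' => absurd h' h⟩

/-- The law of the difference of two independent variables, of law `P`. -/
def diffLaw (P : ProbabilityMeasure ℝ) : ProbabilityMeasure ℝ :=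
  (P.prod P).map (f := fun p : ℝ × ℝ => p.2 - p.1) (by fun_prop)

theorem integral_diffLaw (P : ProbabilityMeasure ℝ) {f : ℝ → ℂ} (hf : Continuous f) {C : ℝ}
    (hC : ∀ x, ‖f x‖ ≤ C) : ∫ s, f s ∂(diffLaw P : Measure ℝ) =
      ∫ u, ∫ v, f (v - u) ∂(P : Measure ℝ) ∂(P : Measure ℝ) := by
  rw [diffLaw, ProbabilityMeasure.toMeasure_map, ProbabilityMeasure.toMeasure_prod,
    integral_map (by fun_prop) hf.aestronglyMeasurable, integral_prod]
  exact Integrable.of_bound (hf.comp (by fun_prop)).aestronglyMeasurable C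
    (ae_of_all _ fun _ => hC _)

theorem sum_product_eq_offDiag_add (s : Finset ℕ) (F : ℕ → ℕ → ℂ) :
    ∑ c ∈ s, ∑ c' ∈ s, F c c' = ∑ p ∈ s.offDiag, F p.1 p.2 + ∑ c ∈ s, F c c := by
  rw [← Finset.sum_product', ← Finset.sum_filter_add_sum_filter_not (s ×ˢ s)
    (fun p => p.1 ≠ p.2)]
  congr 1
  · refine Finset.sum_congr ?_ fun _ _ => rfl
    ext p
    simp [Finset.mem_offDiag, and_assoc]
  · symm
    refine Finset.sum_bij (fun c _ => (c, c)) ?_ ?_ ?_ ?_ <;> simp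
    exact fun _ _ _ h1 h2 => ⟨h1, h2.symm⟩

/-- The sum of `φ(c) ^ 2` over the multiples `c` of `b` with `2 ≤ c ≤ N`, that is the total weight
of the diagonal. -/
def diagMass (b N : ℕ) : ℝ := ∑ c ∈ levelSet b N, (c.totient : ℝ) ^ 2

theorem diagMass_nonneg (b N : ℕ) : 0 ≤ diagMass b N :=
  Finset.sum_nonneg fun _ _ => by positivity

theorem integral_cuspPairCorrelation_one {b N : ℕ} (hN : 0 < N) (hT : 0 < totalMass b N)
    {P : ProbabilityMeasure ℝ} (hP : ∀ g : ℝ → ℂ, ∫ u, g u ∂(P : Measure ℝ) =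
      (∑ c ∈ levelSet b N, (c.totient : ℂ) * g (2 * Real.log (c / N))) / totalMass b N)
    {f : ℝ → ℂ} (hf : Continuous f) {C : ℝ} (hC : ∀ x, ‖f x‖ ≤ C) :
    ∫ s, f s ∂(cuspPairCorrelation b (fun _ => 1) N) =
      totalMass b N ^ 2 * ∫ s, f s ∂(diffLaw P : Measure ℝ) - diagMass b N * f 0 := by
  have hT' : (totalMass b N : ℂ) ≠ 0 := by exact_mod_cast hT.ne'
  have h1 : (totalMass b N : ℂ) ^ 2 * ∫ s, f s ∂(diffLaw P : Measure ℝ) =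
      ∑ c ∈ levelSet b N, ∑ c' ∈ levelSet b N, ((c.totient : ℂ) * c'.totient) *
        f (2 * Real.log c' - 2 * Real.log c) := by
    rw [integral_diffLaw P hf hC, hP]
    simp only [hP]
    rw [Finset.sum_div, Finset.mul_sum]
    refine Finset.sum_congr rfl fun c hc => ?_
    field_simp
    rw [Finset.mul_sum]
    refine Finset.sum_congr rfl fun c' hc' => ?_
    have hc0 : (c : ℝ) ≠ 0 := by have := (mem_levelSet.mp hc).1; positivity
    have hc0' : (c' : ℝ) ≠ 0 := by have := (mem_levelSet.mp hc').1; positivity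
    have hN0 : (N : ℝ) ≠ 0 := by positivity
    rw [Real.log_div hc0 hN0, Real.log_div hc0' hN0, ← mul_assoc]
    congr 2
    ring
  rw [h1, sum_product_eq_offDiag_add, integral_cuspPairCorrelation]
  simp only [one_mul, sub_self]
  rw [diagMass, ← Finset.sum_mul]
  push_cast
  simp only [sq]
  ring

theorem tendsto_diagMass {b : ℕ} {m : ℝ} (hm0 : 0 < m) (hm : HasMean (levelWeight b) m) :
    Tendsto (fun N : ℕ => diagMass b N / totalMass b N ^ 2) atTop (𝓝 0) := by
  have h1 : Tendsto (fun N : ℕ => (1 / (N : ℝ)) / (totalMass b N / (N : ℝ) ^ 2)) atTop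
      (𝓝 (0 / (m / 2))) :=
    tendsto_one_div_atTop_nhds_zero_nat.div (tendsto_totalMass hm) (by positivity)
  rw [zero_div] at h1
  refine squeeze_zero (fun N => div_nonneg (diagMass_nonneg b N) (sq_nonneg _)) (fun N => ?_) h1
  have hD : diagMass b N ≤ N * totalMass b N := by
    rw [diagMass, totalMass, Finset.mul_sum]
    refine Finset.sum_le_sum fun c hc => ?_
    rw [sq]
    gcongr
    exact (Nat.totient_le c).trans (mem_levelSet.mp hc).2.2
  rcases (totalMass_nonneg b N).eq_or_lt with h0 | h0
  · simp [← h0]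
  · rcases N.eq_zero_or_pos with rfl | hN
    · exact absurd h0 (by simp [totalMass, levelSet])
    · have hN0 : (0 : ℝ) < N := by exact_mod_cast hN
      calc diagMass b N / totalMass b N ^ 2 ≤ N * totalMass b N / totalMass b N ^ 2 := by gcongr
        _ = _ := by field_simp

theorem weakStarTendsto_unscaled {b : ℕ} (hb : 0 < b) :
    (∀ᶠ N in atTop, IsProbabilityMeasure ((cuspPairCorrelation b (fun _ => 1) N Set.univ)⁻¹ •
      cuspPairCorrelation b (fun _ => 1) N)) ∧
    WeakStarTendsto (fun N => (cuspPairCorrelation b (fun _ => 1) N Set.univ)⁻¹ •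
      cuspPairCorrelation b (fun _ => 1) N) laplaceMeasure := by
  obtain ⟨m, hm0, hm⟩ := exists_hasMean_levelWeight hb
  choose P hP using exists_levelLaw b
  let P₀ : ProbabilityMeasure ℝ := ⟨negExpMeasure, inferInstance⟩
  have hTm := tendsto_totalMass hm
  have hpos := eventually_totalMass_pos hb
  have hPlim : Tendsto P atTop (𝓝 P₀) := by
    rw [ProbabilityMeasure.tendsto_iff_forall_integral_rclike_tendsto ℂ]
    intro f
    have h1 := tendsto_sum_totient_two_log hm f.continuous f.norm_coe_le_norm
    have h2 := (Complex.continuous_ofReal.tendsto _).comp hTm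
    have hm2 : ((m / 2 : ℝ) : ℂ) ≠ 0 := by exact_mod_cast (by positivity : m / 2 ≠ 0)
    have h3 := h1.div h2 hm2
    rw [show (m : ℂ) / 2 = ((m / 2 : ℝ) : ℂ) by push_cast; rfl, mul_div_cancel_left₀ _ hm2] at h3
    refine h3.congr' ?_
    filter_upwards [hpos, eventually_gt_atTop 0] with N hT hN
    have hN0 : (N : ℂ) ≠ 0 := by exact_mod_cast hN.ne'
    rw [hP N hT, Pi.div_apply, Function.comp_apply]
    push_cast
    field_simp
  have hQlim : Tendsto (fun N => diffLaw (P N)) atTop (𝓝 (diffLaw P₀)) :=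
    ProbabilityMeasure.tendsto_map_of_tendsto_of_continuous _ _
      ((ProbabilityMeasure.continuous_prod.tendsto (P₀, P₀)).comp (hPlim.prodMk_nhds hPlim))
      (by fun_prop)
  have hQ₀ : (diffLaw P₀ : Measure ℝ) = laplaceMeasure := map_sub_negExpMeasure
  have hD := tendsto_diagMass hm0 hm
  have hmass : ∀ᶠ N in atTop, diagMass b N / totalMass b N ^ 2 < 1 ∧
      ((cuspPairCorrelation b (fun _ => 1) N Set.univ).toReal : ℝ) =
        totalMass b N ^ 2 - diagMass b N := by
    filter_upwards [hpos, eventually_gt_atTop 0, hD.eventually_lt_const one_pos] with N hT hN hDN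
    refine ⟨hDN, ?_⟩
    have h := integral_cuspPairCorrelation_one hN hT (hP N hT) (f := fun _ => 1)
      continuous_const (C := 1) (by simp)
    simp only [integral_const, probReal_univ, one_smul, mul_one] at h
    rw [Complex.real_smul, mul_one] at h
    exact_mod_cast h
  have hprob : ∀ᶠ N in atTop, IsProbabilityMeasure
      ((cuspPairCorrelation b (fun _ => 1) N Set.univ)⁻¹ •
        cuspPairCorrelation b (fun _ => 1) N) := by
    filter_upwards [hpos, hmass] with N hT ⟨hDN, hN⟩
    rw [div_lt_one (by positivity)] at hDN
    have : NeZero (cuspPairCorrelation b (fun _ => 1) N) := by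
      refine ⟨fun h0 => ?_⟩
      rw [h0] at hN
      simp at hN
      linarith
    infer_instance
  refine ⟨hprob, ?_, ?_, fun f hf hfc => ?_⟩
  · filter_upwards [hprob] with N hN
    infer_instance
  · rw [← hQ₀]
    infer_instance
  · obtain ⟨C, hC⟩ := hf.bounded_above_of_compact_support hfc
    have hQf : Tendsto (fun N => ∫ s, f s ∂(diffLaw (P N) : Measure ℝ)) atTop
        (𝓝 (∫ s, f s ∂laplaceMeasure)) := by
      rw [← hQ₀]
      exact (ProbabilityMeasure.tendsto_iff_forall_integral_rclike_tendsto ℂ).mp hQlim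
        (BoundedContinuousFunction.ofNormedAddCommGroup f hf C hC)
    have hD' := (Complex.continuous_ofReal.tendsto _).comp hD
    rw [Complex.ofReal_zero] at hD'
    have h1 := (hQf.sub (hD'.mul_const (f 0))).div (tendsto_const_nhds.sub hD')
      (show (1 : ℂ) - 0 ≠ 0 by simp)
    rw [zero_mul, sub_zero, sub_zero, div_one] at h1
    refine h1.congr' ?_
    filter_upwards [hpos, hmass, eventually_gt_atTop 0] with N hT ⟨hDN, hN⟩ hN0
    have hT' : (totalMass b N : ℂ) ≠ 0 := by exact_mod_cast hT.ne'
    rw [integral_smul_measure, ENNReal.toReal_inv, hN,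
      integral_cuspPairCorrelation_one hN0 hT (hP N hT) hf hC, Complex.real_smul]
    rw [div_lt_one (by positivity)] at hDN
    have h2 : (totalMass b N : ℂ) ^ 2 - diagMass b N ≠ 0 := by
      exact_mod_cast (sub_pos.mpr hDN).ne'
    simp only [Pi.div_apply, Function.comp_apply]
    push_cast
    have h3 : (1 : ℂ) - diagMass b N / totalMass b N ^ 2 ≠ 0 := by
      rw [one_sub_div (pow_ne_zero 2 hT')]
      exact div_ne_zero h2 (pow_ne_zero 2 hT')
    rw [div_eq_iff h3]
    field_simp

/-! ### The linearly scaled pair correlations: one shift -/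

/-- The product of the ratios at `n` and `n + k`, restricted to the multiples `n ≥ 2` of `b`. -/
def shiftWeight (b k n : ℕ) : ℝ :=
  if 2 ≤ n ∧ b ∣ n then totientRatio n * totientRatio (n + k) else 0

theorem shiftWeight_mem (b k n : ℕ) : 0 ≤ shiftWeight b k n ∧ shiftWeight b k n ≤ 1 := by
  unfold shiftWeight
  obtain ⟨h1, h2⟩ := totientRatio_mem n
  obtain ⟨h3, h4⟩ := totientRatio_mem (n + k)
  split_ifs
  · exact ⟨mul_nonneg h1 h3, mul_le_one₀ h2 h3 h4⟩
  · norm_num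

theorem hasMean_shiftWeight {b k : ℕ} (hb : 0 < b) (hbk : b ∣ k) :
    HasMean (shiftWeight b k) (mirskyConst b b k) :=
  (hasMean_totientRatio_mul hb hbk).congr 1 fun n hn => by
    simp [shiftWeight, show 2 ≤ n from hn]

theorem mirskyConst_nonneg {b k : ℕ} (hb : 0 < b) (hbk : b ∣ k) : 0 ≤ mirskyConst b b k :=
  ge_of_tendsto' (hasMean_shiftWeight hb hbk) fun N =>
    div_nonneg (Finset.sum_nonneg fun n _ => (shiftWeight_mem b k n).1) (Nat.cast_nonneg N)

/-- The difference between `2 N log (1 + k / n)` and `2 k N / n`. -/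
theorem abs_log_sub_le {N n k : ℕ} (hn : 0 < n) :
    |(N : ℝ) * (2 * Real.log (n + k : ℕ) - 2 * Real.log n) - 2 * k / (n / N)| ≤
      2 * N * (k / n) ^ 2 := by
  have hn0 : (0 : ℝ) < n := by exact_mod_cast hn
  have hk0 : (0 : ℝ) ≤ k := Nat.cast_nonneg k
  have hx : (0 : ℝ) ≤ k / n := by positivity
  have h1 : Real.log (n + k : ℕ) - Real.log n = Real.log (1 + k / n) := by
    rw [← Real.log_div (by positivity) hn0.ne']
    congr 1
    push_cast
    field_simp
  have h2 : (N : ℝ) * (2 * Real.log (n + k : ℕ) - 2 * Real.log n) - 2 * k / (n / N) =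
      2 * N * (Real.log (1 + k / n) - k / n) := by
    rw [← h1]
    field_simp
  have h3 := Real.log_le_sub_one_of_pos (show (0 : ℝ) < 1 + k / n by positivity)
  have h4 := Real.one_sub_inv_le_log_of_pos (show (0 : ℝ) < 1 + k / n by positivity)
  have h5 : (k / n : ℝ) - (k / n) ^ 2 ≤ 1 - (1 + k / n : ℝ)⁻¹ := by
    have h : (1 : ℝ) - (1 + k / n : ℝ)⁻¹ - (k / n - (k / n) ^ 2) =
        (k / n) ^ 3 / (1 + k / n) := by
      have : (1 + k / n : ℝ) ≠ 0 := by positivity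
      field_simp
      ring
    have : (0 : ℝ) ≤ (k / n) ^ 3 / (1 + k / n) := by positivity
    linarith
  rw [h2, abs_mul, abs_of_nonneg (by positivity : (0 : ℝ) ≤ 2 * N)]
  gcongr
  rw [abs_le]
  constructor <;> linarith [sq_nonneg (k / n : ℝ)]

/-- At `t = 0` the argument `2 k / t` takes a junk value, which the factor `t²` makes harmless. -/
theorem continuous_sq_mul_comp_div {f : ℝ → ℂ} (hf : Continuous f) {C : ℝ}
    (hC : ∀ x, ‖f x‖ ≤ C) (k : ℕ) : Continuous fun t : ℝ => (t : ℂ) ^ 2 * f (2 * k / t) := by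
  rw [continuous_iff_continuousAt]
  intro t
  rcases eq_or_ne t 0 with rfl | ht
  · have : Tendsto (fun t : ℝ => (t : ℂ) ^ 2 * f (2 * k / t)) (𝓝 0) (𝓝 0) := by
      refine squeeze_zero_norm (a := fun t : ℝ => |t| ^ 2 * C) (fun t => ?_) ?_
      · rw [norm_mul, norm_pow, Complex.norm_real, Real.norm_eq_abs]
        gcongr
        exact hC _
      · have : Continuous fun t : ℝ => |t| ^ 2 * C := by fun_prop
        simpa using this.tendsto 0
    simpa [ContinuousAt] using this
  · have h2 : ContinuousAt (fun t : ℝ => f (2 * k / t)) t :=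
      hf.continuousAt.comp (continuousAt_const.div continuousAt_id ht)
    exact (Complex.continuous_ofReal.continuousAt.pow 2).mul h2

/-- Uniform convergence of the summands to the function `t ↦ t² f(2 k / t)`. -/
theorem eventually_norm_sub_le {f : ℝ → ℂ} (hf : UniformContinuous f) {C : ℝ}
    (hC : ∀ x, ‖f x‖ ≤ C) (k : ℕ) {ε : ℝ} (hε : 0 < ε) :
    ∀ᶠ N : ℕ in atTop, ∀ n ∈ Finset.Ioc 0 N,
      ‖((n / N : ℝ) : ℂ) * (((n + k : ℕ) / N : ℝ) : ℂ) *
          f (N * (2 * Real.log (n + k : ℕ) - 2 * Real.log n)) -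
        ((n / N : ℝ) : ℂ) ^ 2 * f (2 * k / (n / N))‖ ≤ ε := by
  have hC0 : 0 ≤ C := (norm_nonneg _).trans (hC 0)
  obtain ⟨δ, hδ, hunif⟩ := Metric.uniformContinuous_iff.mp hf (ε / 2) (by positivity)
  have h1 : Tendsto (fun N : ℕ => (4 * C * k ^ 2 / δ) / (N : ℝ)) atTop (𝓝 0) :=
    tendsto_const_div_atTop_nhds_zero_nat _
  have h2 : Tendsto (fun N : ℕ => (k * C) / (N : ℝ)) atTop (𝓝 0) :=
    tendsto_const_div_atTop_nhds_zero_nat _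
  filter_upwards [h1.eventually_le_const (half_pos hε), h2.eventually_le_const (half_pos hε)]
    with N hN1 hN2 n hn
  rw [Finset.mem_Ioc] at hn
  have hn0 : (0 : ℝ) < n := by exact_mod_cast hn.1
  have hN0 : (0 : ℝ) < N := by exact_mod_cast hn.1.trans_le hn.2
  set t : ℝ := n / N with ht
  have ht0 : 0 < t := by positivity
  have ht1 : t ≤ 1 := (div_le_one hN0).mpr (by exact_mod_cast hn.2)
  set s := (N : ℝ) * (2 * Real.log (n + k : ℕ) - 2 * Real.log n) with hs
  have hsum : (((n + k : ℕ) / N : ℝ) : ℂ) = t + (k / N : ℝ) := by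
    rw [← Complex.ofReal_add, ht, ← add_div]
    push_cast
    rfl
  have hsplit : (t : ℂ) * (((n + k : ℕ) / N : ℝ) : ℂ) * f s - (t : ℂ) ^ 2 * f (2 * k / t) =
      (t : ℂ) ^ 2 * (f s - f (2 * k / t)) + (t : ℂ) * ((k / N : ℝ) : ℂ) * f s := by
    rw [hsum]; ring
  have hA : ‖(t : ℂ) * ((k / N : ℝ) : ℂ) * f s‖ ≤ ε / 2 := by
    rw [norm_mul, norm_mul, Complex.norm_real, Complex.norm_real, Real.norm_of_nonneg ht0.le,
      Real.norm_of_nonneg (by positivity)]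
    calc t * (k / N) * ‖f s‖ ≤ 1 * (k / N) * C := by gcongr; exact hC s
      _ = k * C / N := by ring
      _ ≤ ε / 2 := hN2
  -- Either `s` is close to its limit, or `t` is so small that the factor `t²` suffices.
  have hB : ‖(t : ℂ) ^ 2 * (f s - f (2 * k / t))‖ ≤ ε / 2 := by
    rw [norm_mul, norm_pow, Complex.norm_real, Real.norm_of_nonneg ht0.le]
    have hst : |s - 2 * k / t| ≤ 2 * k ^ 2 / (N * t ^ 2) := by
      refine (abs_log_sub_le hn.1).trans (le_of_eq ?_)
      rw [ht]
      field_simp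
    by_cases hd : 2 * (k : ℝ) ^ 2 / (N * t ^ 2) < δ
    · have h3 := (hunif (a := s) (b := 2 * k / t) (by
        rw [Real.dist_eq]; exact hst.trans_lt hd)).le
      rw [dist_eq_norm] at h3
      calc t ^ 2 * ‖f s - f (2 * k / t)‖ ≤ 1 * (ε / 2) := by
            gcongr
            exact pow_le_one₀ ht0.le ht1
        _ = ε / 2 := one_mul _
    · have h3 : t ^ 2 ≤ 2 * (k : ℝ) ^ 2 / (N * δ) := by
        rw [not_lt, le_div_iff₀ (by positivity)] at hd
        rw [le_div_iff₀ (by positivity)]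
        linarith
      have h4 : ‖f s - f (2 * k / t)‖ ≤ C + C := (norm_sub_le _ _).trans (add_le_add (hC _) (hC _))
      calc t ^ 2 * ‖f s - f (2 * k / t)‖ ≤ 2 * (k : ℝ) ^ 2 / (N * δ) * (C + C) := by gcongr
        _ = 4 * C * k ^ 2 / δ / N := by field_simp; ring
        _ ≤ ε / 2 := hN1
  rw [hsplit]
  exact (norm_add_le _ _).trans (by linarith)

/-- The contribution of the pairs `(c, c + k)` to the linearly scaled pair correlations. -/
theorem tendsto_shift_sum {b k : ℕ} (hb : 0 < b) (hbk : b ∣ k) {f : ℝ → ℂ}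
    (hf : UniformContinuous f) {C : ℝ} (hC : ∀ x, ‖f x‖ ≤ C) :
    Tendsto (fun N : ℕ => (∑ c ∈ levelSet b N with c + k ≤ N,
        ((c.totient : ℂ) * (c + k).totient) *
          f (N * (2 * Real.log (c + k : ℕ) - 2 * Real.log c))) / (N : ℂ) ^ 3) atTop
      (𝓝 (mirskyConst b b k * ∫ t in (0 : ℝ)..1, (t : ℂ) ^ 2 * f (2 * k / t))) := by
  have hC0 : 0 ≤ C := (norm_nonneg _).trans (hC 0)
  set G : ℕ → ℕ → ℂ := fun N n => ((n / N : ℝ) : ℂ) * (((n + k : ℕ) / N : ℝ) : ℂ) *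
          f (N * (2 * Real.log (n + k : ℕ) - 2 * Real.log n)) with hG
  have h1 := tendsto_weighted_riemann_sum (hasMean_shiftWeight hb hbk)
    (fun n => (shiftWeight_mem b k n).1) (fun n => (shiftWeight_mem b k n).2)
    (continuous_sq_mul_comp_div hf.continuous hC k).continuousOn (G := G)
    (fun ε hε => eventually_norm_sub_le hf hC k hε)
  -- The integers `n ≤ N` with `n + k > N` are at most `k` and contribute `O(1 / N)`.
  have h2 : Tendsto (fun N : ℕ => (∑ n ∈ Finset.Ioc (N - k) N, (shiftWeight b k n : ℂ) * G N n) /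
      N) atTop (𝓝 0) := by
    refine squeeze_zero_norm' (a := fun N : ℕ => (k * (2 * C)) / (N : ℝ)) ?_
      (tendsto_const_div_atTop_nhds_zero_nat _)
    filter_upwards [eventually_ge_atTop (k + 1)] with N hN
    have hN0 : (0 : ℝ) < N := by exact_mod_cast (by omega : 0 < N)
    rw [norm_div, Complex.norm_natCast]
    gcongr
    refine (norm_sum_le _ _).trans ((Finset.sum_le_card_nsmul _ _ (2 * C) fun n hn => ?_).trans ?_)
    · rw [Finset.mem_Ioc] at hn
      have hnN : (n : ℝ) / N ≤ 1 := (div_le_one hN0).mpr (by exact_mod_cast hn.2)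
      have hnk : ((n + k : ℕ) : ℝ) / N ≤ 2 := by
        rw [div_le_iff₀ hN0]
        exact_mod_cast (by omega : n + k ≤ 2 * N)
      simp only [hG]
      rw [norm_mul, norm_mul, norm_mul, Complex.norm_real, Complex.norm_real, Complex.norm_real,
        Real.norm_of_nonneg (shiftWeight_mem b k n).1, Real.norm_of_nonneg (by positivity),
        Real.norm_of_nonneg (by positivity)]
      calc _ ≤ 1 * (1 * 2 * C) := by
            gcongr
            · exact (shiftWeight_mem b k n).2
            · exact hC _
        _ = 2 * C := by ring
    · rw [Nat.card_Ioc, nsmul_eq_mul]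
      gcongr
      omega
  have h3 := h1.sub h2
  rw [sub_zero] at h3
  refine h3.congr' ?_
  filter_upwards [eventually_ge_atTop (k + 1)] with N hN
  have hN0 : (N : ℂ) ≠ 0 := by exact_mod_cast (by omega : N ≠ 0)
  have hcons := Finset.sum_Ioc_consecutive (fun n => (shiftWeight b k n : ℂ) * G N n)
    (Nat.zero_le (N - k)) (Nat.sub_le N k)
  rw [← sub_div, ← hcons, add_sub_cancel_right]
  have hset : (levelSet b N).filter (fun c => c + k ≤ N) =
      (Finset.Ioc 0 (N - k)).filter fun c => 2 ≤ c ∧ b ∣ c := by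
    ext c
    simp only [Finset.mem_filter, mem_levelSet, Finset.mem_Ioc]
    constructor
    · rintro ⟨⟨h1, h2, h3⟩, h4⟩
      exact ⟨⟨by omega, by omega⟩, h1, h2⟩
    · rintro ⟨⟨h1, h2⟩, h3, h4⟩
      exact ⟨⟨h3, h4, by omega⟩, by omega⟩
  rw [hset, Finset.sum_filter, Finset.sum_div, Finset.sum_div]
  refine Finset.sum_congr rfl fun n hn => ?_
  have hn0 : (n : ℂ) ≠ 0 := by exact_mod_cast (Finset.mem_Ioc.mp hn).1.ne'
  have hnk0 : ((n : ℂ) + k) ≠ 0 := by exact_mod_cast (show n + k ≠ 0 by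
    have := (Finset.mem_Ioc.mp hn).1; omega)
  unfold shiftWeight
  split_ifs
  · simp only [hG, totientRatio]
    push_cast
    field_simp
  · simp

theorem integral_sq_mul_comp {k : ℕ} (hk : 0 < k) (f : ℝ → ℂ) :
    ∫ t in (0 : ℝ)..1, (t : ℂ) ^ 2 * f (2 * k / t) =
      ∫ s, (((Set.Ici (2 * k : ℝ)).indicator (fun s => 8 * (k : ℝ) ^ 3 / s ^ 4) s : ℝ) : ℂ) *
        f s := by
  have hk0 : (0 : ℝ) < 2 * k := by positivity
  have himage : (fun s : ℝ => 2 * k / s) '' Set.Ici (2 * k : ℝ) = Set.Ioc 0 1 := by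
    ext t
    constructor
    · rintro ⟨s, hs, rfl⟩
      have hs0 : 0 < s := hk0.trans_le hs
      exact ⟨by positivity, (div_le_one hs0).mpr hs⟩
    · rintro ⟨h0, h1⟩
      refine ⟨2 * k / t, ?_, by beta_reduce; field_simp⟩
      rw [Set.mem_Ici, le_div_iff₀ h0]
      exact mul_le_of_le_one_right hk0.le h1
  have hderiv : ∀ s ∈ Set.Ici (2 * k : ℝ), HasDerivWithinAt (fun s : ℝ => 2 * k / s)
      (-(2 * k) / s ^ 2) (Set.Ici (2 * k : ℝ)) s := by
    intro s hs
    have hs0 : s ≠ 0 := (hk0.trans_le hs).ne'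
    have h := ((hasDerivAt_const s (2 * k : ℝ)).div (hasDerivAt_id s) hs0).hasDerivWithinAt
      (s := Set.Ici (2 * k : ℝ))
    rwa [zero_mul, mul_one, zero_sub] at h
  have hinj : Set.InjOn (fun s : ℝ => 2 * k / s) (Set.Ici (2 * k : ℝ)) := by
    intro s hs s' hs' h
    have hs0 : s ≠ 0 := (hk0.trans_le hs).ne'
    have hs0' : s' ≠ 0 := (hk0.trans_le hs').ne'
    beta_reduce at h
    rw [div_eq_div_iff hs0 hs0'] at h
    exact (mul_left_cancel₀ hk0.ne' h).symm
  rw [intervalIntegral.integral_of_le zero_le_one, ← himage,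
    integral_image_eq_integral_abs_deriv_smul measurableSet_Ici hderiv hinj,
    ← integral_indicator measurableSet_Ici]
  refine integral_congr_ae (ae_of_all _ fun s => ?_)
  simp only [Set.indicator_apply]
  split_ifs with hs
  · have hs0 : 0 < s := hk0.trans_le hs
    rw [neg_div, abs_neg, abs_of_pos (by positivity), Complex.real_smul,
      show 2 * (k : ℝ) / (2 * k / s) = s by field_simp]
    have : (s : ℂ) ≠ 0 := by exact_mod_cast hs0.ne'
    push_cast
    field_simp
    ring
  · simp

/-! ### The linearly scaled pair correlations -/

theorem sum_offDiag_eq (s : Finset ℕ) (X : ℕ → ℕ → ℂ) :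
    ∑ p ∈ s.offDiag, X p.1 p.2 = ∑ p ∈ s ×ˢ s with p.1 < p.2, X p.1 p.2 +
      ∑ p ∈ s ×ˢ s with p.1 < p.2, X p.2 p.1 := by
  rw [← Finset.sum_filter_add_sum_filter_not s.offDiag (fun p => p.1 < p.2)]
  congr 1
  · refine Finset.sum_congr ?_ fun _ _ => rfl
    ext p
    simp only [Finset.mem_filter, Finset.mem_offDiag, Finset.mem_product]
    constructor
    · rintro ⟨⟨h1, h2, -⟩, h3⟩
      exact ⟨⟨h1, h2⟩, h3⟩
    · rintro ⟨⟨h1, h2⟩, h3⟩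
      exact ⟨⟨h1, h2, h3.ne⟩, h3⟩
  · refine Finset.sum_bij' (fun p _ => p.swap) (fun p _ => p.swap) ?_ ?_ ?_ ?_ ?_
    · rintro ⟨x, y⟩ h
      simp only [Finset.mem_filter, Finset.mem_offDiag, Finset.mem_product, Prod.swap] at h ⊢
      exact ⟨⟨h.1.2.1, h.1.1⟩, by omega⟩
    · rintro ⟨x, y⟩ h
      simp only [Finset.mem_filter, Finset.mem_offDiag, Finset.mem_product, Prod.swap] at h ⊢
      exact ⟨⟨h.1.2, h.1.1, by omega⟩, by omega⟩
    · simp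
    · simp
    · simp

/-- Sorting the increasing pairs of the level set by their difference. -/
theorem sum_increasing_pairs {b N K : ℕ} (X : ℕ → ℕ → ℂ)
    (hX : ∀ c ∈ levelSet b N, ∀ c' ∈ levelSet b N, c + K < c' → X c c' = 0) :
    ∑ p ∈ levelSet b N ×ˢ levelSet b N with p.1 < p.2, X p.1 p.2 =
      ∑ k ∈ Finset.Ioc 0 K with b ∣ k, ∑ c ∈ levelSet b N with c + k ≤ N, X c (c + k) := by
  rw [Finset.sum_sigma']
  symm
  refine Finset.sum_bij_ne_zero (fun x _ _ => (x.2, x.2 + x.1)) ?_ ?_ ?_ ?_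
  · rintro ⟨k, c⟩ h -
    simp only [Finset.mem_sigma, Finset.mem_filter, Finset.mem_Ioc, mem_levelSet,
      Finset.mem_product] at h ⊢
    obtain ⟨⟨⟨h1, h2⟩, h3⟩, ⟨h4, h5, h6⟩, h7⟩ := h
    exact ⟨⟨⟨h4, h5, h6⟩, by omega, h5.add h3, h7⟩, by omega⟩
  · rintro ⟨k, c⟩ h - ⟨k', c'⟩ h' - he
    simp only [Prod.mk.injEq] at he
    obtain ⟨rfl, he⟩ := he
    obtain rfl : k = k' := by omega
    rfl
  · rintro ⟨c, c'⟩ h h0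
    simp only [Finset.mem_filter, Finset.mem_product] at h
    obtain ⟨⟨h1, h2⟩, h3⟩ := h
    have hcK : ¬ c + K < c' := fun hlt => h0 (hX c h1 c' h2 hlt)
    obtain ⟨h4, h5, h6⟩ := mem_levelSet.mp h1
    obtain ⟨h7, h8, h9⟩ := mem_levelSet.mp h2
    have he : c + (c' - c) = c' := by omega
    refine ⟨⟨c' - c, c⟩, ?_, ?_, ?_⟩
    · simp only [Finset.mem_sigma, Finset.mem_filter, Finset.mem_Ioc, mem_levelSet]
      exact ⟨⟨⟨by omega, by omega⟩, Nat.dvd_sub h8 h5⟩, ⟨h4, h5, h6⟩, by omega⟩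
    · simp only [he]
      exact h0
    · simp only [he]
  · rintro ⟨k, c⟩ h -
    rfl

theorem lt_mul_log_sub {N c c' K : ℕ} (hc : 0 < c) (hcN : c' ≤ N) (h : c + K < c') :
    (2 * K : ℝ) < N * (2 * Real.log c' - 2 * Real.log c) := by
  have hc0 : (0 : ℝ) < c := by exact_mod_cast hc
  have hc0' : (0 : ℝ) < c' := by exact_mod_cast (by omega : 0 < c')
  have h1 := Real.one_sub_inv_le_log_of_pos (show (0 : ℝ) < c' / c by positivity)
  rw [Real.log_div hc0'.ne' hc0.ne', inv_div] at h1
  have h2 : (c' - c : ℝ) ≤ c' * (Real.log c' - Real.log c) := by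
    calc (c' - c : ℝ) = c' * (1 - c / c') := by field_simp
      _ ≤ _ := by gcongr
  have h3 : (K : ℝ) < c' - c := by
    have : ((c + K : ℕ) : ℝ) < c' := by exact_mod_cast h
    push_cast at this
    linarith
  have h4 : 0 < Real.log c' - Real.log c := by
    by_contra hneg
    have := mul_nonpos_of_nonneg_of_nonpos hc0'.le (not_lt.mp hneg)
    have hK : (0 : ℝ) ≤ K := Nat.cast_nonneg K
    linarith
  have h5 : (c' : ℝ) * (Real.log c' - Real.log c) ≤ N * (Real.log c' - Real.log c) := by
    gcongr
  linarith

/-- The contribution of the increasing pairs, for a test function supported in `[-2 K, 2 K]`: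
only the differences `k ≤ K` are involved. -/
theorem tendsto_sum_increasing {b : ℕ} (hb : 0 < b) {f : ℝ → ℂ} (hf : UniformContinuous f) {C : ℝ}
    (hC : ∀ x, ‖f x‖ ≤ C) {K : ℕ} (hK : ∀ x, 2 * (K : ℝ) < x → f x = 0) :
    Tendsto (fun N : ℕ => (∑ p ∈ levelSet b N ×ˢ levelSet b N with p.1 < p.2,
        ((p.1.totient : ℂ) * p.2.totient) *
          f (N * (2 * Real.log p.2 - 2 * Real.log p.1))) / (N : ℂ) ^ 3) atTop
      (𝓝 (∑ k ∈ Finset.Ioc 0 K with b ∣ k, mirskyConst b b k *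
        ∫ s, (((Set.Ici (2 * k : ℝ)).indicator (fun s => 8 * (k : ℝ) ^ 3 / s ^ 4) s : ℝ) : ℂ) *
          f s)) := by
  have h := tendsto_finsetSum ((Finset.Ioc 0 K).filter (b ∣ ·)) fun k hk =>
    tendsto_shift_sum hb (Finset.mem_filter.mp hk).2 hf hC
  have he : ∀ k ∈ (Finset.Ioc 0 K).filter (b ∣ ·),
      (mirskyConst b b k : ℂ) * ∫ t in (0 : ℝ)..1, (t : ℂ) ^ 2 * f (2 * k / t) =
      mirskyConst b b k * ∫ s, (((Set.Ici (2 * k : ℝ)).indicator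
        (fun s => 8 * (k : ℝ) ^ 3 / s ^ 4) s : ℝ) : ℂ) * f s := fun k hk => by
    rw [integral_sq_mul_comp (Finset.mem_Ioc.mp (Finset.mem_filter.mp hk).1).1]
  rw [Finset.sum_congr rfl he] at h
  refine h.congr fun N => ?_
  rw [← Finset.sum_div]
  congr 1
  rw [sum_increasing_pairs (b := b) (N := N) (K := K)
    (fun c c' => ((c.totient : ℂ) * c'.totient) * f (N * (2 * Real.log c' - 2 * Real.log c)))]
  intro c hc c' hc' hlt
  rw [hK _ (lt_mul_log_sub (by have := (mem_levelSet.mp hc).1; omega)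
    (mem_levelSet.mp hc').2.2 hlt), mul_zero]

/-! ### The limit density for the linear scaling -/

/-- The contribution of the difference `k` to the limit density. -/
def shiftDensity (k : ℕ) (s : ℝ) : ℝ :=
  (Set.Ici (2 * k : ℝ)).indicator (fun s => 8 * (k : ℝ) ^ 3 / s ^ 4) |s|

theorem measurable_shiftDensity (k : ℕ) : Measurable (shiftDensity k) := by
  have : Measurable fun s : ℝ => 8 * (k : ℝ) ^ 3 / s ^ 4 := by fun_prop
  exact (this.indicator measurableSet_Ici).comp measurable_norm

theorem abs_shiftDensity_le {k : ℕ} (hk : 0 < k) (s : ℝ) : |shiftDensity k s| ≤ 8 * k ^ 3 := by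
  have hk1 : (1 : ℝ) ≤ k := by exact_mod_cast hk
  simp only [shiftDensity, Set.indicator_apply, Set.mem_Ici]
  split_ifs with h
  · rw [abs_of_nonneg (by positivity)]
    refine div_le_self (by positivity) (one_le_pow₀ (by linarith))
  · rw [abs_zero]; positivity

theorem integrable_shiftDensity_mul {k : ℕ} (hk : 0 < k) {f : ℝ → ℂ} (hf : Integrable f) :
    Integrable fun s => (shiftDensity k s : ℂ) * f s := by
  refine hf.bdd_mul (c := 8 * k ^ 3)
    (Complex.measurable_ofReal.comp (measurable_shiftDensity k)).aestronglyMeasurable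
    (ae_of_all _ fun s => ?_)
  rw [Complex.norm_real]
  exact abs_shiftDensity_le hk s

/-- Both signs of the difference together yield an even density. -/
theorem integral_shiftDensity {k : ℕ} (hk : 0 < k) {f : ℝ → ℂ} (hf : Integrable f) :
    (∫ s, (((Set.Ici (2 * k : ℝ)).indicator (fun s => 8 * (k : ℝ) ^ 3 / s ^ 4) s : ℝ) : ℂ) * f s) +
      ∫ s, (((Set.Ici (2 * k : ℝ)).indicator (fun s => 8 * (k : ℝ) ^ 3 / s ^ 4) s : ℝ) : ℂ) *
        f (-s) = ∫ s, (shiftDensity k s : ℂ) * f s := by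
  have hk0 : (0 : ℝ) < 2 * k := by positivity
  have hpos : ∀ s, (((Set.Ici (2 * k : ℝ)).indicator (fun s => 8 * (k : ℝ) ^ 3 / s ^ 4) s : ℝ) :
      ℂ) * f s = (Set.Ioi 0).indicator (fun s => (shiftDensity k s : ℂ) * f s) s := by
    intro s
    simp only [shiftDensity, Set.indicator_apply, Set.mem_Ici, Set.mem_Ioi]
    by_cases hs : 0 < s
    · rw [if_pos hs, abs_of_pos hs]
    · rw [if_neg hs, if_neg (by linarith)]
      simp
  have hneg : ∀ s, (((Set.Ici (2 * k : ℝ)).indicator (fun s => 8 * (k : ℝ) ^ 3 / s ^ 4) (-s) : ℝ) :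
      ℂ) * f s = (Set.Iic 0).indicator (fun s => (shiftDensity k s : ℂ) * f s) s := by
    intro s
    simp only [shiftDensity, Set.indicator_apply, Set.mem_Ici, Set.mem_Iic]
    by_cases hs : s ≤ 0
    · rw [if_pos hs, abs_of_nonpos hs]
    · rw [if_neg hs, if_neg (by linarith)]
      simp
  have hI := integrable_shiftDensity_mul hk hf
  rw [← integral_neg_eq_self (fun s => (((Set.Ici (2 * k : ℝ)).indicator
    (fun s => 8 * (k : ℝ) ^ 3 / s ^ 4) s : ℝ) : ℂ) * f (-s))]
  simp only [neg_neg, hpos, hneg]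
  rw [integral_indicator measurableSet_Ioi, integral_indicator measurableSet_Iic, add_comm,
    intervalIntegral.integral_Iic_add_Ioi hI.integrableOn hI.integrableOn]

theorem linearDensity_nonneg {b : ℕ} (hb : 0 < b) (s : ℝ) : 0 ≤ linearDensity b s := by
  refine mul_nonneg (by positivity) (Finset.sum_nonneg fun k hk => ?_)
  exact mul_nonneg (mirskyConst_nonneg hb (Finset.mem_filter.mp hk).2) (by positivity)

theorem linearDensity_eq_sum {b K : ℕ} {s : ℝ} (hs : |s| ≤ 2 * K) :
    linearDensity b s = ∑ k ∈ Finset.Ioc 0 K with b ∣ k, mirskyConst b b k * shiftDensity k s := by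
  have h1 : ∀ k : ℕ, (2 * k : ℝ) ≤ |s| ↔ k ≤ ⌊|s| / 2⌋₊ := fun k => by
    rw [Nat.le_floor_iff (by positivity), le_div_iff₀ two_pos, mul_comm]
  have hfl : ⌊|s| / 2⌋₊ ≤ K := Nat.floor_le_of_le (by linarith)
  simp only [shiftDensity, Set.indicator_apply, Set.mem_Ici, mul_ite, mul_zero, h1]
  rw [← Finset.sum_filter, linearDensity, Finset.mul_sum]
  refine Finset.sum_congr ?_ fun k _ => ?_
  · ext k
    simp only [Finset.mem_filter, Finset.mem_Icc, Finset.mem_Ioc]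
    constructor
    · rintro ⟨⟨h2, h3⟩, h4⟩
      exact ⟨⟨⟨by omega, by omega⟩, h4⟩, h3⟩
    · rintro ⟨⟨⟨h2, h3⟩, h4⟩, h5⟩
      exact ⟨⟨by omega, h5⟩, h4⟩
  · rw [Even.pow_abs (by decide)]
    ring

theorem measurable_linearDensity (b : ℕ) : Measurable (linearDensity b) := by
  have h1 : Measurable fun s : ℝ => ⌊|s| / 2⌋₊ :=
    Nat.measurable_floor.comp (measurable_norm.div_const 2)
  have h2 : Measurable fun n : ℕ =>
      ∑ k ∈ (Finset.Icc 1 n).filter (b ∣ ·), mirskyConst b b k * (k : ℝ) ^ 3 :=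
    measurable_from_top
  have h3 : Measurable fun s : ℝ => 8 / s ^ 4 := by fun_prop
  exact h3.mul (h2.comp h1)

/-- The measure on the real line whose density is the limit pair correlation function. -/
def linearMeasure (b : ℕ) : Measure ℝ :=
  volume.withDensity fun s : ℝ => ENNReal.ofReal (linearDensity b s)

theorem isLocallyFiniteMeasure_linearMeasure (b : ℕ) :
    IsLocallyFiniteMeasure (linearMeasure b) := by
  refine ⟨fun x => ⟨Metric.ball x 1, Metric.ball_mem_nhds x one_pos, ?_⟩⟩
  obtain ⟨K, hK⟩ := exists_nat_ge ((|x| + 1) / 2)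
  set M := ∑ k ∈ Finset.Ioc 0 K with b ∣ k, |mirskyConst b b k| * (8 * (k : ℝ) ^ 3) with hM
  rw [linearMeasure, withDensity_apply _ measurableSet_ball]
  calc _ ≤ ∫⁻ _ in Metric.ball x 1, ENNReal.ofReal M := by
        refine setLIntegral_mono measurable_const fun s hs => ENNReal.ofReal_le_ofReal ?_
        have hs1 : |s| ≤ 2 * K := by
          rw [Metric.mem_ball, Real.dist_eq] at hs
          have := abs_sub_abs_le_abs_sub s x
          linarith
        rw [linearDensity_eq_sum hs1]
        refine Finset.sum_le_sum fun k hk => (le_abs_self _).trans ?_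
        rw [abs_mul]
        gcongr
        exact abs_shiftDensity_le (Finset.mem_Ioc.mp (Finset.mem_filter.mp hk).1).1 s
    _ < ⊤ := by
        rw [setLIntegral_const]
        exact ENNReal.mul_lt_top ENNReal.ofReal_lt_top measure_ball_lt_top

theorem integral_linearMeasure {b : ℕ} (hb : 0 < b) {K : ℕ} {f : ℝ → ℂ} (hf : Integrable f)
    (hK : ∀ x, 2 * (K : ℝ) < |x| → f x = 0) :
    ∫ s, f s ∂(linearMeasure b) =
      ∑ k ∈ Finset.Ioc 0 K with b ∣ k, mirskyConst b b k * ∫ s, (shiftDensity k s : ℂ) * f s := by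
  rw [linearMeasure, integral_withDensity_eq_integral_toReal_smul
    (measurable_linearDensity b).ennreal_ofReal (ae_of_all _ fun _ => ENNReal.ofReal_lt_top)]
  simp only [← integral_const_mul]
  rw [← integral_finsetSum]
  · refine integral_congr_ae (ae_of_all _ fun s => ?_)
    beta_reduce
    rw [ENNReal.toReal_ofReal (linearDensity_nonneg hb s), Complex.real_smul]
    by_cases hs : |s| ≤ 2 * K
    · rw [linearDensity_eq_sum hs, Complex.ofReal_sum, Finset.sum_mul]
      simp only [Complex.ofReal_mul, mul_assoc]
    · simp [hK s (not_le.mp hs)]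
  · intro k hk
    exact (integrable_shiftDensity_mul
      (Finset.mem_Ioc.mp (Finset.mem_filter.mp hk).1).1 hf).const_mul _

theorem weakStarTendsto_linear {b : ℕ} (hb : 0 < b) :
    WeakStarTendsto (fun N => ((N : ℝ≥0∞) ^ 3)⁻¹ • cuspPairCorrelation b (fun M => (M : ℝ)) N)
      (linearMeasure b) := by
  refine ⟨?_, isLocallyFiniteMeasure_linearMeasure b, fun f hf hfc => ?_⟩
  · filter_upwards [eventually_gt_atTop 0] with N hN
    have : IsFiniteMeasure (((N : ℝ≥0∞) ^ 3)⁻¹ • cuspPairCorrelation b (fun M => (M : ℝ)) N) :=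
      Measure.smul_finite _ (ENNReal.inv_ne_top.mpr (by positivity))
    infer_instance
  · obtain ⟨C, hC⟩ := hf.bounded_above_of_compact_support hfc
    obtain ⟨R, hR⟩ := hfc.isCompact.isBounded.subset_closedBall 0
    obtain ⟨K, hK⟩ := exists_nat_ge (R / 2)
    have hsupp : ∀ x, 2 * (K : ℝ) < |x| → f x = 0 := by
      intro x hx
      by_contra h0
      have := hR (subset_tsupport f h0)
      rw [Metric.mem_closedBall, dist_zero_right, Real.norm_eq_abs] at this
      linarith
    have hint : Integrable f := hf.integrable_of_hasCompactSupport hfc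
    have hfu : UniformContinuous f := hfc.uniformContinuous_of_continuous hf
    have h1 := tendsto_sum_increasing hb hfu hC (K := K)
      fun x hx => hsupp x (hx.trans_le (le_abs_self x))
    have h2 := tendsto_sum_increasing hb (f := fun s => f (-s)) (hfu.comp uniformContinuous_neg)
      (fun x => hC (-x)) (K := K)
      fun x hx => hsupp (-x) (by rw [abs_neg]; exact hx.trans_le (le_abs_self x))
    have h3 := h1.add h2
    rw [← Finset.sum_add_distrib] at h3
    have he : ∫ s, f s ∂(linearMeasure b) = _ := integral_linearMeasure hb hint hsupp
    rw [he, Finset.sum_congr rfl fun k hk => by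
      rw [← integral_shiftDensity (Finset.mem_Ioc.mp (Finset.mem_filter.mp hk).1).1 hint, mul_add]]
    refine h3.congr fun N => ?_
    rw [integral_smul_measure, integral_cuspPairCorrelation, sum_offDiag_eq (levelSet b N)
      (fun c c' => ((c.totient : ℂ) * c'.totient) * f (N * (2 * Real.log c' - 2 * Real.log c))),
      ← add_div, Complex.real_smul, div_eq_inv_mul]
    congr 1
    · simp
    · congr 1
      refine Finset.sum_congr rfl fun p _ => ?_
      rw [mul_comm (p.1.totient : ℂ), ← mul_neg, neg_sub]

end PairCorr

end

theorem corollary6p2 (b : ℕ) (hb : 0 < b) :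
    ((∀ᶠ N in Filter.atTop, MeasureTheory.IsProbabilityMeasure
        ((PairCorr.cuspPairCorrelation b (fun _ => 1) N Set.univ)⁻¹ •
          PairCorr.cuspPairCorrelation b (fun _ => 1) N)) ∧
      PairCorr.WeakStarTendsto
        (fun N => (PairCorr.cuspPairCorrelation b (fun _ => 1) N Set.univ)⁻¹ •
          PairCorr.cuspPairCorrelation b (fun _ => 1) N)
        (MeasureTheory.volume.withDensity
          fun s : ℝ => ENNReal.ofReal (1 / 2 * Real.exp (-|s|)))) ∧
    PairCorr.WeakStarTendsto
      (fun N => ((N : ENNReal) ^ 3)⁻¹ • PairCorr.cuspPairCorrelation b (fun M => (M : ℝ)) N)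
      (MeasureTheory.volume.withDensity
        fun s : ℝ => ENNReal.ofReal (PairCorr.linearDensity b s)) :=
  ⟨PairCorr.weakStarTendsto_unscaled hb, PairCorr.weakStarTendsto_linear hb⟩
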